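/- **Corollary (a simple guaranteed estimate with the given element matrices $\widehat{\mathsf A}_K$).** *Setting.* Let $d\ge 1$ and let $\Omega\subset\mathbb R^d$ be an open bounded connected polytope with Lipschitz boundary. Let $\mathcal T_H$ be a polytopal mesh of $\overline\Omega$: finitely many closed polytopes $K$, contractible and with Lipschitz boundary, with a conforming simplicial mesh $\mathcal T_h$ of $\Omega$ that restricts to a simplicial mesh $\mathcal T_K$ of each $K$. Let $\mathcal F_H$ be the set of the flat $(d-1)$-dimensional faces of $\mathcal T_H$ and $\mathcal F_K$ those of $K$; each face is a union of faces of $\mathcal T_h$ and either lies in two different elements or lies in some $K\cap\partial\Omega$. Each $\sigma\in\mathcal F_H$ has a fixed unit normal $\boldsymbol n_\sigma$ (exterior to $\Omega$ if $\sigma\subset\partial\Omega$); $\boldsymbol n_K$ is the unit normal pointing out of $K$, and $s_{K\sigma}:=\boldsymbol n_K\cdot\boldsymbol n_\sigma\in\{-1,1\}$ for $\sigma\in\mathcal F_K$. Let $\mathcal V_{K,h}$ be the set of vertices of $\mathcal T_K$, and $\mathcal F_{K,h}^{\rm ext}$ the set of the faces $\tau$ of $\mathcal T_h$ that lie in some face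 of $\mathcal F_H$ and on $\partial K$. Let $f$ and the symmetric positive definite tensor $\boldsymbol K$ be constant on each $K\in\mathcal T_H$. Let $p\in H^1_0(\Omega)$ satisfy $(\boldsymbol K\nabla p,\nabla v)=(f,v)$ for all $v\in H^1_0(\Omega)$, and let $\boldsymbol u:=-\boldsymbol K\nabla p$. Put $\|\boldsymbol v\|_{\boldsymbol K^{-1/2},D}^2:=\int_D|\boldsymbol K^{-1/2}\boldsymbol v|^2$ (the index $D$ is dropped if $D=\Omega$) and $\mathsf F_K:=(f,1)_K$. *Scheme.* Let $\mathsf U\in\mathbb R^{|\mathcal F_H|}$ and $\mathsf P\in\mathbb R^{|\mathcal T_H|}$ solve $$\begin{pmatrix}\mathsf A&\mathsf B^{\rm t}\\ \mathsf B&0\end{pmatrix}\begin{pmatrix}\mathsf U\\ \mathsf P\end{pmatrix}=\begin{pmatrix}0\\-\mathsf F\end{pmatrix},$$ where $\mathsf B_{K,\sigma}=-s_{K\sigma}$ if $\sigma\in\mathcal F_K$ and $0$ otherwise, $\mathsf B$ has full rank $|\mathcal T_H|$, $\mathsf A$ is invertible, and $$\mathsf A_{\sigma,\sigma'}=\sum_{K:\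 \{\sigma,\sigma'\}\subset\mathcal F_K}s_{K\sigma}s_{K\sigma'}(\widehat{\mathsf A}_K)_{\sigma,\sigma'}$$ with symmetric positive definite matrices $\widehat{\mathsf A}_K\in\mathbb R^{|\mathcal F_K|\times|\mathcal F_K|}$. Write $\mathsf U_K:=\{s_{K\sigma}\mathsf U_\sigma\}_{\sigma\in\mathcal F_K}$ for the fluxes oriented out of $K$. Let $\tilde{\boldsymbol u}_h$ be a lifting of the fluxes: on each $K$, $\tilde{\boldsymbol u}_h|_K\in \boldsymbol H({\rm div},K)$, $\nabla\cdot\tilde{\boldsymbol u}_h|_K=f|_K$, the normal trace of $\tilde{\boldsymbol u}_h|_K$ on each $\sigma\in\mathcal F_K$ is an integrable function $\tilde{\boldsymbol u}_h\cdot\boldsymbol n_\sigma$ on $\sigma$, the same from both elements sharing $\sigma$ (for instance the constant $\mathsf U_\sigma/|\sigma|$), with $$\int_\sigma\tilde{\boldsymbol u}_h\cdot\boldsymbol n_\sigma=\mathsf U_\sigma,\qquad \|\tilde{\boldsymbol u}_h\|_{\boldsymbol K^{-1/2},K}^2=\mathsf U_K^{\rm t}\,\widehat{\mathsf A}_K\,\mathsf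 U_K .$$ *Point values.* Let $\Lambda_\sigma:=\mathsf P_K-\sum_{\sigma'\in\mathcal F_K}s_{K\sigma'}(\widehat{\mathsf A}_K)_{\sigma,\sigma'}\mathsf U_{\sigma'}$ for any $K$ with $\sigma\in\mathcal F_K$. For a vertex $\boldsymbol a$ of $\mathcal T_h$ let $\mathsf Z_{\boldsymbol a}:=0$ if $\boldsymbol a\in\partial\Omega$, $\mathsf Z_{\boldsymbol a}:=\mathsf P_K$ if $\boldsymbol a$ lies in the interior of $K$, and otherwise let $\mathsf Z_{\boldsymbol a}$ be the mean of $\Lambda_\sigma$ over the faces $\sigma\in\mathcal F_H$ containing $\boldsymbol a$. Let $\mathsf Z_K:=\{\mathsf Z_{\boldsymbol a}\}_{\boldsymbol a\in\mathcal V_{K,h}}$ and $\mathsf Z_K^{\rm ext}:=\{\mathsf Z_\tau\}_{\tau\in\mathcal F_{K,h}^{\rm ext}}$, where $\mathsf Z_\tau$ is the mean of $\mathsf Z_{\boldsymbol a}$ over the $d$ vertices of $\tau$. Let $\mathsf U_K^{\rm ext}:=\{s_{K\sigma}\mathsf U_\sigma|\tau|/|\sigma|\}_{\tau\in\mathcal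 F_{K,h}^{\rm ext}}$, where $\sigma$ is the polytopal face containing $\tau$. With the hat functions $\psi_{\boldsymbol a}$ of the continuous piecewise affine functions on $\mathcal T_h$, let $(\widehat{\mathsf S}_K)_{\boldsymbol a,\boldsymbol a'}:=(\boldsymbol K\nabla\psi_{\boldsymbol a'},\nabla\psi_{\boldsymbol a})_K$ and $(\widehat{\mathsf M}_K)_{\boldsymbol a,\boldsymbol a'}:=(\psi_{\boldsymbol a'},\psi_{\boldsymbol a})_K$ for $\boldsymbol a,\boldsymbol a'\in\mathcal V_{K,h}$, and $$\eta_K^2:=\mathsf U_K^{\rm t}\widehat{\mathsf A}_K\mathsf U_K+\mathsf Z_K^{\rm t}\widehat{\mathsf S}_K\mathsf Z_K+2(\mathsf U_K^{\rm ext})^{\rm t}\mathsf Z_K^{\rm ext}-2\,\mathsf F_K|K|^{-1}\,\mathsf 1^{\rm t}\widehat{\mathsf M}_K\mathsf Z_K .$$ *Claim.* The multipliers $\Lambda_\sigma$ do not depend on the choice of $K$, $\tilde{\boldsymbol u}_h\in\boldsymbol H({\rm div},\Omega)$ with $\nabla\cdot\tilde{\boldsymbol u}_h=f$, the sum $\sum_{K}\eta_K^2$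 is nonnegative, and $$\|\boldsymbol u-\tilde{\boldsymbol u}_h\|_{\boldsymbol K^{-1/2}}\le\Bigl\{\sum_{K\in\mathcal T_H}\eta_K^2\Bigr\}^{1/2}.$$ -/

import Mathlib

open MeasureTheory Set Filter Topology
open scoped ContDiff ENNReal NNReal RealInnerProductSpace Matrix

noncomputable section

/-- The Euclidean space of dimension `d`. -/
abbrev Eu (d : ℕ) : Type := EuclideanSpace ℝ (Fin d)

/-! ### Lipschitz sets -/

/-- Near each boundary point, and in a suitable direction `e`, the set `S` is the strict hypograph of
a Lipschitz function of the component orthogonal to `e`, and its boundary is the graph. -/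
def HasLipschitzBoundary {d : ℕ} (S : Set (Eu d)) : Prop :=
  ∀ x ∈ frontier S, ∃ U : Set (Eu d), IsOpen U ∧ x ∈ U ∧
    ∃ e : Eu d, ‖e‖ = 1 ∧ ∃ (C : ℝ≥0) (γ : Eu d → ℝ), LipschitzWith C γ ∧
      ∀ y ∈ U, (y ∈ interior S ↔ ⟪e, y⟫ < γ (y - ⟪e, y⟫ • e)) ∧
        (y ∈ frontier S ↔ ⟪e, y⟫ = γ (y - ⟪e, y⟫ • e))

/-! ### Sobolev spaces -/

/-- Smooth functions with compact support contained in `Ω`. -/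
structure IsTestFunction {d : ℕ} (Ω : Set (Eu d)) (φ : Eu d → ℝ) : Prop where
  smooth : ContDiff ℝ ∞ φ
  compact : HasCompactSupport φ
  support : tsupport φ ⊆ Ω

/-- `v ∈ H¹(Ω)` with weak gradient `g`. -/
structure HasWeakGradient {d : ℕ} (Ω : Set (Eu d)) (v : Eu d → ℝ) (g : Eu d → Eu d) : Prop where
  memLp : MemLp v 2 (volume.restrict Ω)
  memLp_grad : MemLp g 2 (volume.restrict Ω)
  integral_eq : ∀ φ, IsTestFunction Ω φ → ∀ i : Fin d,
    ∫ x in Ω, v x * gradient φ x i = - ∫ x in Ω, g x i * φ x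

/-- `v ∈ H(div, Ω)` with weak divergence `w`. -/
structure HasWeakDivergence {d : ℕ} (Ω : Set (Eu d)) (v : Eu d → Eu d) (w : Eu d → ℝ) : Prop where
  memLp : MemLp v 2 (volume.restrict Ω)
  memLp_div : MemLp w 2 (volume.restrict Ω)
  integral_eq : ∀ φ, IsTestFunction Ω φ →
    ∫ x in Ω, ⟪v x, gradient φ x⟫ = - ∫ x in Ω, w x * φ x

/-- `v ∈ H¹₀(Ω)` with weak gradient `g`: `v` is the limit in `H¹(Ω)` of smooth functions with compact
support in `Ω`. -/
structure IsH10 {d : ℕ} (Ω : Set (Eu d)) (v : Eu d → ℝ) (g : Eu d → Eu d) : Prop where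
  weakGradient : HasWeakGradient Ω v g
  approx : ∃ φ : ℕ → Eu d → ℝ, (∀ n, IsTestFunction Ω (φ n)) ∧
    Tendsto (fun n => eLpNorm (fun x => φ n x - v x) 2 (volume.restrict Ω)) atTop (𝓝 0) ∧
    Tendsto (fun n => eLpNorm (fun x => gradient (φ n) x - g x) 2 (volume.restrict Ω)) atTop (𝓝 0)

/-! ### The Darcy problem -/

/-- `p`, with weak gradient `g`, is the weak solution of `-div (𝐊 ∇p) = f` in `Ω`, `p = 0` on `∂Ω`. -/
structure IsDarcySolution {d : ℕ} (Ω : Set (Eu d)) (Km : Eu d → Matrix (Fin d) (Fin d) ℝ)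
    (f : Eu d → ℝ) (p : Eu d → ℝ) (g : Eu d → Eu d) : Prop where
  isH10 : IsH10 Ω p g
  weak_eq : ∀ v gv, IsH10 Ω v gv →
    ∫ x in Ω, ⟪(Km x).toEuclideanLin (g x), gv x⟫ = ∫ x in Ω, f x * v x

/-- The exact flux `-𝐊 ∇p`. -/
def darcyFlux {d : ℕ} (Km : Eu d → Matrix (Fin d) (Fin d) ℝ) (g : Eu d → Eu d) : Eu d → Eu d :=
  fun x => - (Km x).toEuclideanLin (g x)

/-- The square of the energy norm of `v` on `D`, that is, the integral of
`|𝐊^{-1/2} v|² = v · 𝐊⁻¹ v`. -/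
def energySq {d : ℕ} (Km : Eu d → Matrix (Fin d) (Fin d) ℝ) (D : Set (Eu d)) (v : Eu d → Eu d) : ℝ :=
  ∫ x in D, ⟪v x, ((Km x)⁻¹).toEuclideanLin (v x)⟫

/-- The energy norm. -/
def energyNorm {d : ℕ} (Km : Eu d → Matrix (Fin d) (Fin d) ℝ) (D : Set (Eu d))
    (v : Eu d → Eu d) : ℝ :=
  √(energySq Km D v)

/-! ### Meshes -/

/-- The union of the simplices whose vertex sets are listed in `S`. -/
def simplexUnion {d : ℕ} (S : Finset (Finset (Eu d))) : Set (Eu d) :=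
  ⋃ κ ∈ S, convexHull ℝ (κ : Set (Eu d))

open Classical in
/-- The `(d-1)`-dimensional faces of the simplices listed in `S` (each given by its vertices). -/
def facets {d : ℕ} (S : Finset (Finset (Eu d))) : Finset (Finset (Eu d)) :=
  S.biUnion fun κ => κ.powersetCard d

/-- A conforming simplicial mesh of `Ω`; a closed simplex is represented by its set of vertices. -/
structure SimplicialMesh (d : ℕ) (Ω : Set (Eu d)) where
  simplices : Finset (Finset (Eu d))
  card_eq : ∀ κ ∈ simplices, κ.card = d + 1
  affineIndependent : ∀ κ ∈ simplices, AffineIndependent ℝ ((↑) : κ → Eu d)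
  union_eq : simplexUnion simplices = closure Ω
  inter_eq : ∀ κ ∈ simplices, ∀ κ' ∈ simplices,
    convexHull ℝ (κ : Set (Eu d)) ∩ convexHull ℝ (κ' : Set (Eu d)) =
      convexHull ℝ ((κ : Set (Eu d)) ∩ (κ' : Set (Eu d)))

/-- `n` is the unit normal of the flat piece `s` of the boundary of `S`, pointing out of `S`. -/
structure IsOutwardNormal {d : ℕ} (S s : Set (Eu d)) (n : Eu d) : Prop where
  norm_eq : ‖n‖ = 1
  orthogonal : ∀ x ∈ s, ∀ y ∈ s, ⟪n, x - y⟫ = 0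
  outward : ∀ x ∈ intrinsicInterior ℝ s,
    ∀ᶠ t : ℝ in 𝓝[>] 0, x - t • n ∈ interior S ∧ x + t • n ∉ S

/-- A polytopal mesh of `Ω`, with elements indexed by `ι` and faces indexed by `Φ`, together with a
conforming simplicial submesh.  The element `K` is the union of the simplices of `submesh K`.  The
faces are flat, are unions of faces of the simplicial mesh, and either lie in two different elements
or lie on the boundary of `Ω`; those contained in the boundary of an element cover this boundary. -/
structure PolytopalMesh (d : ℕ) (Ω : Set (Eu d)) (ι Φ : Type*) [Fintype ι] [Fintype Φ]
    extends SimplicialMesh d Ω where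
  submesh : ι → Finset (Finset (Eu d))
  submesh_nonempty : ∀ K, (submesh K).Nonempty
  submesh_disjoint : ∀ K L, K ≠ L → Disjoint (submesh K) (submesh L)
  submesh_cover : ∀ κ, κ ∈ simplices ↔ ∃ K, κ ∈ submesh K
  /-- Elements are homotopy equivalent to a ball. -/
  elem_contractible : ∀ K, ContractibleSpace (simplexUnion (submesh K))
  elem_lipschitz : ∀ K, HasLipschitzBoundary (simplexUnion (submesh K))
  face : Φ → Set (Eu d)
  face_nonempty : ∀ σ, (face σ).Nonempty
  face_eq : ∀ σ, face σ =
    ⋃ τ ∈ {τ | τ ∈ facets simplices ∧ convexHull ℝ (τ : Set (Eu d)) ⊆ face σ},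
      convexHull ℝ (τ : Set (Eu d))
  face_unique : ∀ τ ∈ facets simplices, ∀ σ σ',
    convexHull ℝ (τ : Set (Eu d)) ⊆ face σ → convexHull ℝ (τ : Set (Eu d)) ⊆ face σ' → σ = σ'
  face_interior_or_boundary : ∀ σ,
    (∃ K L, K ≠ L ∧ face σ ⊆ simplexUnion (submesh K) ∩ simplexUnion (submesh L)) ∨
      (∃ K, face σ ⊆ simplexUnion (submesh K) ∩ frontier Ω)
  frontier_eq : ∀ K, frontier (simplexUnion (submesh K)) =
    ⋃ σ ∈ {σ | face σ ⊆ frontier (simplexUnion (submesh K))}, face σ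
  /-- The fixed unit normal of each face. -/
  normal : Φ → Eu d
  normal_norm : ∀ σ, ‖normal σ‖ = 1
  normal_orthogonal : ∀ σ, ∀ x ∈ face σ, ∀ y ∈ face σ, ⟪normal σ, x - y⟫ = 0
  normal_boundary : ∀ σ, face σ ⊆ frontier Ω → IsOutwardNormal (closure Ω) (face σ) (normal σ)
  /-- The unit normal of a face of an element, pointing out of the element. -/
  outNormal : ι → Φ → Eu d
  outNormal_spec : ∀ K σ, face σ ⊆ frontier (simplexUnion (submesh K)) →
    IsOutwardNormal (simplexUnion (submesh K)) (face σ) (outNormal K σ)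

namespace PolytopalMesh

variable {d : ℕ} {Ω : Set (Eu d)} {ι Φ : Type*} [Fintype ι] [Fintype Φ]

/-- The closed polytopal element `K`. -/
def elem (M : PolytopalMesh d Ω ι Φ) (K : ι) : Set (Eu d) := simplexUnion (M.submesh K)

open Classical in
/-- The faces of the element `K`. -/
def elemFaces (M : PolytopalMesh d Ω ι Φ) (K : ι) : Finset Φ :=
  Finset.univ.filter fun σ => M.face σ ⊆ frontier (M.elem K)

/-- `n_K · n_σ`. -/
def sgn (M : PolytopalMesh d Ω ι Φ) (K : ι) (σ : Φ) : ℝ := ⟪M.outNormal K σ, M.normal σ⟫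

/-- `|σ|`, the `(d-1)`-dimensional measure of the face `σ`. -/
def faceMeasure (M : PolytopalMesh d Ω ι Φ) (σ : Φ) : ℝ := (μHE[d - 1]).real (M.face σ)

/-- `|K|`. -/
def elemMeasure (M : PolytopalMesh d Ω ι Φ) (K : ι) : ℝ := volume.real (M.elem K)

open Classical in
/-- The faces of the simplicial submesh which lie in some polytopal face. -/
def subfaces (M : PolytopalMesh d Ω ι Φ) : Finset (Finset (Eu d)) :=
  (facets M.simplices).filter fun τ => ∃ σ, convexHull ℝ (τ : Set (Eu d)) ⊆ M.face σ

open Classical in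
/-- The faces from `subfaces` which lie on the boundary of the element `K`. -/
def extSubfaces (M : PolytopalMesh d Ω ι Φ) (K : ι) : Finset (Finset (Eu d)) :=
  M.subfaces.filter fun τ => convexHull ℝ (τ : Set (Eu d)) ⊆ frontier (M.elem K)

theorem exists_parent (M : PolytopalMesh d Ω ι Φ) {K : ι} {τ : Finset (Eu d)}
    (h : τ ∈ M.extSubfaces K) : ∃ σ, convexHull ℝ (τ : Set (Eu d)) ⊆ M.face σ := by
  classical
  exact (Finset.mem_filter.1 (Finset.mem_filter.1 h).1).2

/-- The (unique) polytopal face which contains the subface `τ`. -/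
def parent (M : PolytopalMesh d Ω ι Φ) (K : ι) (τ : M.extSubfaces K) : Φ :=
  (M.exists_parent τ.2).choose

open Classical in
/-- The vertices of the simplicial submesh of the element `K`. -/
def elemVertices (M : PolytopalMesh d Ω ι Φ) (K : ι) : Finset (Eu d) :=
  (M.submesh K).biUnion id

/-- `w` is the family of barycentric coordinates of `x` in the simplex with vertex set `κ`, extended
by zero. -/
structure _root_.IsBarycentric (κ : Finset (Eu d)) (x : Eu d) (w : Eu d → ℝ) : Prop where
  nonneg : ∀ b ∈ κ, 0 ≤ w b
  sum_eq : ∑ b ∈ κ, w b = 1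
  sum_smul : ∑ b ∈ κ, w b • b = x
  zero : ∀ b, b ∉ κ → w b = 0

open Classical in
/-- The hat function of the vertex `a`: on each simplex of the mesh it is the barycentric coordinate
of `a` (zero if `a` is not a vertex of the simplex), hence it is continuous on the closure of `Ω`,
piecewise affine, one at `a` and zero at the other vertices. -/
def hat (M : PolytopalMesh d Ω ι Φ) (a x : Eu d) : ℝ :=
  if h : ∃ w : Eu d → ℝ, ∃ κ ∈ M.simplices, IsBarycentric κ x w then h.choose a else 0

/-- The element stiffness matrix. -/
def stiffness (M : PolytopalMesh d Ω ι Φ) (Km : Eu d → Matrix (Fin d) (Fin d) ℝ) (K : ι) :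
    Matrix (M.elemVertices K) (M.elemVertices K) ℝ :=
  fun a a' => ∫ x in M.elem K,
    ⟪(Km x).toEuclideanLin (gradient (M.hat a') x), gradient (M.hat a) x⟫

/-- The element mass matrix. -/
def mass (M : PolytopalMesh d Ω ι Φ) (K : ι) :
    Matrix (M.elemVertices K) (M.elemVertices K) ℝ :=
  fun a a' => ∫ x in M.elem K, M.hat a' x * M.hat a x

/-- The load `F_K`. -/
def load (M : PolytopalMesh d Ω ι Φ) (f : Eu d → ℝ) (K : ι) : ℝ := ∫ x in M.elem K, f x

open Classical in
/-- The global matrix assembled from element matrices. -/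
def assembleA (M : PolytopalMesh d Ω ι Φ)
    (Ahat : (K : ι) → Matrix (M.elemFaces K) (M.elemFaces K) ℝ) : Matrix Φ Φ ℝ :=
  fun σ σ' => ∑ K, if h : σ ∈ M.elemFaces K ∧ σ' ∈ M.elemFaces K then
    M.sgn K σ * M.sgn K σ' * Ahat K ⟨σ, h.1⟩ ⟨σ', h.2⟩ else 0

open Classical in
/-- The divergence matrix. -/
def matB (M : PolytopalMesh d Ω ι Φ) : Matrix ι Φ ℝ :=
  fun K σ => if σ ∈ M.elemFaces K then - M.sgn K σ else 0

end PolytopalMesh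

/-! ### Saddle-point discretizations -/

open Classical in
/-- A locally conservative saddle-point discretization with symmetric positive definite element
matrices, together with its solution `(U, P)`. -/
structure SaddlePointScheme {d : ℕ} {Ω : Set (Eu d)} {ι Φ : Type*} [Fintype ι] [Fintype Φ]
    (M : PolytopalMesh d Ω ι Φ) (f : Eu d → ℝ) where
  Ahat : (K : ι) → Matrix (M.elemFaces K) (M.elemFaces K) ℝ
  Ahat_posDef : ∀ K, (Ahat K).PosDef
  A_invertible : IsUnit (M.assembleA Ahat)
  B_fullRank : M.matB.rank = Fintype.card ι
  U : Φ → ℝ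
  P : ι → ℝ
  system : Matrix.fromBlocks (M.assembleA Ahat) M.matBᵀ M.matB 0 *ᵥ Sum.elim U P =
    Sum.elim (0 : Φ → ℝ) (fun K => - M.load f K)

namespace SaddlePointScheme

variable {d : ℕ} {Ω : Set (Eu d)} {ι Φ : Type*} [Fintype ι] [Fintype Φ]
  {M : PolytopalMesh d Ω ι Φ} {f : Eu d → ℝ}

/-- The face normal fluxes of the element `K`, oriented out of `K`. -/
def elemFlux (S : SaddlePointScheme M f) (K : ι) : M.elemFaces K → ℝ :=
  fun σ => M.sgn K σ * S.U σ

/-- The normal fluxes through the simplicial subfaces on the boundary of `K`, oriented out of `K`. -/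
def extFlux (S : SaddlePointScheme M f) (K : ι) : M.extSubfaces K → ℝ :=
  fun τ => M.sgn K (M.parent K τ) * (S.U (M.parent K τ) / M.faceMeasure (M.parent K τ) *
    (μHE[d - 1]).real (convexHull ℝ ((τ : Finset (Eu d)) : Set (Eu d))))

/-- The field `ut` is a lifting of the face normal fluxes in all elements: on each element `K` it is
in `H(div, K)` with divergence `f`, its normal trace `φ ↦ ∫_K (ut · ∇φ + (div ut) φ)` is given on each
face `σ` by an integrable density `g σ` of `ut · n_σ` (the same from both sides of `σ`) whose
integral is the flux `U_σ`, and its energy is the one of the element matrix.  A constant normal trace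
`g σ = U_σ / |σ|` is a particular case. -/
structure IsLifting (S : SaddlePointScheme M f) (Km : Eu d → Matrix (Fin d) (Fin d) ℝ)
    (ut : Eu d → Eu d) : Prop where
  divergence : ∀ K, HasWeakDivergence (interior (M.elem K)) ut f
  normalFlux : ∃ g : Φ → Eu d → ℝ,
    (∀ σ, IntegrableOn (g σ) (M.face σ) μHE[d - 1]) ∧
    (∀ K, ∀ φ : Eu d → ℝ, ContDiff ℝ ∞ φ → HasCompactSupport φ →
      ∫ x in M.elem K, (⟪ut x, gradient φ x⟫ + f x * φ x) =
        ∑ σ ∈ M.elemFaces K, M.sgn K σ * ∫ x in M.face σ, g σ x * φ x ∂μHE[d - 1]) ∧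
    (∀ σ, ∫ x in M.face σ, g σ x ∂μHE[d - 1] = S.U σ)
  energy : ∀ K, energySq Km (M.elem K) ut = S.elemFlux K ⬝ᵥ (S.Ahat K *ᵥ S.elemFlux K)

/-- The Lagrange multiplier of a face `σ` of `K`, computed from the element `K`. -/
def elemMultiplier (S : SaddlePointScheme M f) (K : ι) (σ : M.elemFaces K) : ℝ :=
  S.P K - ∑ σ' : M.elemFaces K, M.sgn K σ' * S.Ahat K σ σ' * S.U σ'

open Classical in
/-- The Lagrange multiplier of the face `σ`, computed from any element with this face. -/
def multiplier (S : SaddlePointScheme M f) (σ : Φ) : ℝ :=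
  if h : ∃ K, σ ∈ M.elemFaces K then S.elemMultiplier h.choose ⟨σ, h.choose_spec⟩ else 0

open Classical in
/-- The potential point value at the vertex `a`: zero on the boundary of `Ω`, the element potential
inside an element, the mean of the multipliers of the faces sharing `a` otherwise. -/
def pointValue (S : SaddlePointScheme M f) (a : Eu d) : ℝ :=
  if a ∈ frontier Ω then 0
  else if h : ∃ K, a ∈ interior (M.elem K) then S.P h.choose
  else (∑ σ ∈ Finset.univ.filter (fun σ => a ∈ M.face σ), S.multiplier σ) /
    ((Finset.univ.filter (fun σ => a ∈ M.face σ)).card : ℝ)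

/-- The potential value of a simplicial face: the mean of the values at its vertices. -/
def subfaceValue (S : SaddlePointScheme M f) (τ : Finset (Eu d)) : ℝ :=
  1 / (d : ℝ) * ∑ a ∈ τ, S.pointValue a

/-- The element vector of the values at the vertices of the submesh of `K`. -/
def Z (S : SaddlePointScheme M f) (K : ι) : M.elemVertices K → ℝ := fun a => S.pointValue a

/-- The element vector of the values of the simplicial faces on the boundary of `K`. -/
def Zext (S : SaddlePointScheme M f) (K : ι) : M.extSubfaces K → ℝ := fun τ => S.subfaceValue τ

/-- The square of the element estimator. -/
def etaSq (S : SaddlePointScheme M f) (Km : Eu d → Matrix (Fin d) (Fin d) ℝ) (K : ι) : ℝ :=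
  S.elemFlux K ⬝ᵥ (S.Ahat K *ᵥ S.elemFlux K)
    + S.Z K ⬝ᵥ (M.stiffness Km K *ᵥ S.Z K)
    + 2 * (S.extFlux K ⬝ᵥ S.Zext K)
    - 2 * M.load f K * (M.elemMeasure K)⁻¹ * ((fun _ => 1) ⬝ᵥ (M.mass K *ᵥ S.Z K))

end SaddlePointScheme

end

/-! ### Barycentric coordinates -/

/-! The argument is of Prager–Synge type. Let `s` be the continuous piecewise affine function with
vertex values `S.pointValue`. Expanding the square, Green's formula for the lifting against `p` and
the weak equation tested with `p` give `‖u - ũ‖² = ∫ ũ·K⁻¹ũ - ∫ f p`. Testing with `s` and using `2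
K∇p·∇s ≤ K∇p·∇p + K∇s·∇s` gives `-∫ f p ≤ ∫ K∇s·∇s - 2 ∫ f s`. Hence the squared error is at most `∫
ũ·K⁻¹ũ + ∫ K∇s·∇s - 2 ∫ f s`, which is the sum of the estimators: the first term is the element
energy of the lifting, the second is the stiffness form, the third is the mass term because `f` is
constant on elements, and the boundary flux terms cancel in the sum.

All face cancellations have one source (`sum_sum_sgn_mul_eq_zero`): an interior face belongs to
exactly two elements with opposite signs, and the quantity at hand vanishes on faces in `∂Ω`. It
gives the global divergence of the lifting (`IsLifting.hasWeakDivergence`) and the vanishing flux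
terms (`sum_extFlux_dotProduct_Zext`). The two opposite signs also make the multipliers single
valued.

The analytic work is `s ∈ H¹₀`. By `mem_frontier_of_isBarycentric`, a boundary point is carried by
boundary vertices only, so `s` vanishes off `Ω`. Then `s` is globally Lipschitz, and
`LipschitzWith.isH10` approximates it by truncated mollifications. Of the point values, only their
vanishing on `∂Ω` matters for the bound. -/

namespace IsBarycentric

variable {d : ℕ} {κ κ' : Finset (Eu d)} {x : Eu d} {w w' : Eu d → ℝ}

theorem mem_convexHull (h : IsBarycentric κ x w) : x ∈ convexHull ℝ (κ : Set (Eu d)) :=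
  Finset.mem_convexHull'.2 ⟨w, h.nonneg, h.sum_eq, h.sum_smul⟩

theorem mono (h : IsBarycentric κ x w) (hκ : κ ⊆ κ') : IsBarycentric κ' x w where
  nonneg b _ := by
    by_cases hb : b ∈ κ
    · exact h.nonneg b hb
    · exact (h.zero b hb).ge
  sum_eq := by
    rw [← h.sum_eq]
    exact (Finset.sum_subset hκ fun b _ hb => h.zero b hb).symm
  sum_smul := by
    rw [← h.sum_smul]
    exact (Finset.sum_subset hκ fun b _ hb => by rw [h.zero b hb, zero_smul]).symm
  zero b hb := h.zero b fun hb' => hb (hκ hb')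

theorem nonneg_all (h : IsBarycentric κ x w) (b : Eu d) : 0 ≤ w b := by
  by_cases hb : b ∈ κ
  · exact h.nonneg b hb
  · exact (h.zero b hb).ge

theorem le_one (h : IsBarycentric κ x w) (b : Eu d) : w b ≤ 1 := by
  by_cases hb : b ∈ κ
  · rw [← h.sum_eq]
    exact Finset.single_le_sum (f := w) (fun i hi => h.nonneg i hi) hb
  · rw [h.zero b hb]
    exact zero_le_one

theorem unique (hκ : AffineIndependent ℝ ((↑) : κ → Eu d)) (h : IsBarycentric κ x w)
    (h' : IsBarycentric κ x w') : w = w' := by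
  funext b
  by_cases hb : b ∈ κ
  · have := affineIndependent_iff.1 hκ Finset.univ (fun i => w i - w' i) (by
      rw [Finset.sum_sub_distrib, Finset.sum_coe_sort κ w, Finset.sum_coe_sort κ w', h.sum_eq,
        h'.sum_eq, sub_self]) (by
      simp only [sub_smul]
      rw [Finset.sum_sub_distrib, Finset.sum_coe_sort κ fun i => w i • i,
        Finset.sum_coe_sort κ fun i => w' i • i, h.sum_smul, h'.sum_smul, sub_self]) ⟨b, hb⟩
      (Finset.mem_univ _)
    exact sub_eq_zero.1 this
  · rw [h.zero b hb, h'.zero b hb]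

end IsBarycentric

theorem exists_isBarycentric {d : ℕ} {κ : Finset (Eu d)} {x : Eu d}
    (h : x ∈ convexHull ℝ (κ : Set (Eu d))) : ∃ w, IsBarycentric κ x w := by
  classical
  obtain ⟨w, h0, h1, h2⟩ := Finset.mem_convexHull'.1 h
  refine ⟨fun b => if b ∈ κ then w b else 0, fun b hb => ?_, ?_, ?_, fun b hb => if_neg hb⟩
  · rw [if_pos hb]
    exact h0 b hb
  · rw [← h1]
    exact Finset.sum_congr rfl fun b hb => if_pos hb
  · rw [← h2]
    exact Finset.sum_congr rfl fun b hb => by rw [if_pos hb]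

theorem isCompact_convexHull_finset {d : ℕ} (κ : Finset (Eu d)) :
    IsCompact (convexHull ℝ (κ : Set (Eu d))) :=
  κ.finite_toSet.isCompact_convexHull ℝ

theorem isClosed_convexHull_finset {d : ℕ} (κ : Finset (Eu d)) :
    IsClosed (convexHull ℝ (κ : Set (Eu d))) :=
  (isCompact_convexHull_finset κ).isClosed

theorem mem_simplexUnion {d : ℕ} {S : Finset (Finset (Eu d))} {x : Eu d} :
    x ∈ simplexUnion S ↔ ∃ κ ∈ S, x ∈ convexHull ℝ (κ : Set (Eu d)) := by
  simp [simplexUnion]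

theorem isCompact_simplexUnion {d : ℕ} (S : Finset (Finset (Eu d))) :
    IsCompact (simplexUnion S) :=
  S.finite_toSet.isCompact_biUnion fun κ _ => isCompact_convexHull_finset κ

/-! ### Simplicial meshes -/

namespace SimplicialMesh

variable {d : ℕ} {Ω : Set (Eu d)} (M : SimplicialMesh d Ω) {κ κ' : Finset (Eu d)}

/-- By conformity, a point of two simplices lies in the hull of their common vertices, so both
families of coordinates equal the one of that common face. This makes the hat functions well
defined. -/
theorem isBarycentric_unique (hκ : κ ∈ M.simplices) (hκ' : κ' ∈ M.simplices) {x : Eu d}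
    {w w' : Eu d → ℝ} (h : IsBarycentric κ x w) (h' : IsBarycentric κ' x w') : w = w' := by
  classical
  have hx : x ∈ convexHull ℝ ((κ ∩ κ' : Finset (Eu d)) : Set (Eu d)) := by
    rw [Finset.coe_inter, ← M.inter_eq κ hκ κ' hκ']
    exact ⟨h.mem_convexHull, h'.mem_convexHull⟩
  obtain ⟨w'', h''⟩ := exists_isBarycentric hx
  rw [h.unique (M.affineIndependent κ hκ) (h''.mono Finset.inter_subset_left),
    h'.unique (M.affineIndependent κ' hκ') (h''.mono Finset.inter_subset_right)]

/-- The vertices of a simplex of the mesh, as an affine basis of the space. -/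
noncomputable def affineBasis (hκ : κ ∈ M.simplices) : AffineBasis κ ℝ (Eu d) where
  toFun := (↑)
  ind' := M.affineIndependent κ hκ
  tot' := by
    rw [(M.affineIndependent κ hκ).affineSpan_eq_top_iff_card_eq_finrank_add_one]
    simp [M.card_eq κ hκ]

theorem affineBasis_apply (hκ : κ ∈ M.simplices) (b : κ) : M.affineBasis hκ b = b := rfl

theorem range_affineBasis (hκ : κ ∈ M.simplices) :
    range (M.affineBasis hκ) = (κ : Set (Eu d)) := by
  ext x
  simp [affineBasis_apply]

theorem coord_eq (hκ : κ ∈ M.simplices) {x : Eu d} {w : Eu d → ℝ} (h : IsBarycentric κ x w)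
    (b : κ) : (M.affineBasis hκ).coord b x = w b := by
  classical
  have hx : x ∈ convexHull ℝ (range (M.affineBasis hκ)) := by
    rw [M.range_affineBasis hκ]
    exact h.mem_convexHull
  rw [AffineBasis.convexHull_eq_nonneg_coord] at hx
  let v : Eu d → ℝ := fun a => if ha : a ∈ κ then (M.affineBasis hκ).coord ⟨a, ha⟩ x else 0
  have hv : ∀ a : κ, v a = (M.affineBasis hκ).coord a x := fun a => dif_pos a.2
  have : IsBarycentric κ x v := by
    refine ⟨fun a ha => ?_, ?_, ?_, fun a ha => dif_neg ha⟩
    · rw [hv ⟨a, ha⟩]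
      exact hx _
    · rw [← Finset.sum_coe_sort κ v]
      simp only [hv]
      exact AffineBasis.sum_coord_apply_eq_one _ x
    · rw [← Finset.sum_coe_sort κ fun a => v a • a]
      simp only [hv]
      exact AffineBasis.linear_combination_coord_eq_self _ x
  rw [← hv, this.unique (M.affineIndependent κ hκ) h]

theorem interior_convexHull_nonempty (hκ : κ ∈ M.simplices) :
    (interior (convexHull ℝ (κ : Set (Eu d)))).Nonempty := by
  rw [interior_convexHull_nonempty_iff_affineSpan_eq_top, ← M.range_affineBasis hκ]
  exact (M.affineBasis hκ).tot

theorem pos_of_mem_interior (hκ : κ ∈ M.simplices) {x : Eu d} {w : Eu d → ℝ}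
    (h : IsBarycentric κ x w) (hx : x ∈ interior (convexHull ℝ (κ : Set (Eu d)))) (b : Eu d)
    (hb : b ∈ κ) : 0 < w b := by
  rw [← M.range_affineBasis hκ, AffineBasis.interior_convexHull] at hx
  rw [← M.coord_eq hκ h ⟨b, hb⟩]
  exact hx _

/-- All coordinates of an interior point of `κ` are positive, while its coordinates in `κ'` vanish
off `κ'`; so `κ ⊆ κ'`, and both have `d + 1` vertices. -/
theorem eq_of_mem_interior (hκ : κ ∈ M.simplices) (hκ' : κ' ∈ M.simplices) {x : Eu d}
    (hx : x ∈ interior (convexHull ℝ (κ : Set (Eu d))))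
    (hx' : x ∈ convexHull ℝ (κ' : Set (Eu d))) : κ = κ' := by
  obtain ⟨w, hw⟩ := exists_isBarycentric (interior_subset hx)
  obtain ⟨w', hw'⟩ := exists_isBarycentric hx'
  have := M.isBarycentric_unique hκ hκ' hw hw'
  subst this
  refine Finset.eq_of_subset_of_card_le (fun b hb => ?_) (by rw [M.card_eq κ hκ, M.card_eq κ' hκ'])
  by_contra hb'
  exact (M.pos_of_mem_interior hκ hw hx b hb).ne' (hw'.zero b hb')

theorem volume_frontier_convexHull (κ : Finset (Eu d)) :
    volume (frontier (convexHull ℝ (κ : Set (Eu d)))) = 0 :=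
  (convex_convexHull ℝ _).addHaar_frontier volume

theorem convexHull_ae_eq_interior (κ : Finset (Eu d)) :
    convexHull ℝ (κ : Set (Eu d)) =ᵐ[volume] interior (convexHull ℝ (κ : Set (Eu d))) :=
  (interior_ae_eq_of_null_frontier (volume_frontier_convexHull κ)).symm

theorem convexHull_subset_closure (hκ : κ ∈ M.simplices) :
    convexHull ℝ (κ : Set (Eu d)) ⊆ closure Ω := by
  rw [← M.union_eq]
  exact fun x hx => mem_simplexUnion.2 ⟨κ, hκ, hx⟩

theorem convexHull_subset_closure_interior (hκ : κ ∈ M.simplices) :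
    convexHull ℝ (κ : Set (Eu d)) ⊆ closure (interior (convexHull ℝ (κ : Set (Eu d)))) := by
  rw [(convex_convexHull ℝ _).closure_interior_eq_closure_of_nonempty_interior
    (M.interior_convexHull_nonempty hκ)]
  exact subset_closure

end SimplicialMesh

/-- A Lipschitz open set is the interior of its closure. -/
theorem HasLipschitzBoundary.interior_closure {d : ℕ} {Ω : Set (Eu d)} (hΩ : IsOpen Ω)
    (h : HasLipschitzBoundary Ω) : interior (closure Ω) = Ω := by
  refine Subset.antisymm (fun x hx => ?_) hΩ.subset_interior_closure
  by_contra hxΩ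
  have hxf : x ∈ frontier Ω := by
    rw [hΩ.frontier_eq]
    exact ⟨interior_subset hx, hxΩ⟩
  obtain ⟨U, hU, hxU, e, he, C, γ, -, hy⟩ := h x hxf
  have h0 : ⟪e, x⟫ = γ (x - ⟪e, x⟫ • e) := (hy x hxU).2.1 hxf
  -- Moving `x` by `t • e` raises the height and keeps the projection, so the new point is strictly
  -- above the graph. It is then neither in the interior nor on the frontier of `Ω`, though still in
  -- the closure for small `t`.
  have hc : Tendsto (fun t : ℝ => x + t • e) (𝓝[>] 0) (𝓝 x) := by
    have : Continuous fun t : ℝ => x + t • e := by fun_prop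
    have := this.tendsto 0
    simp only [zero_smul, add_zero] at this
    exact this.mono_left nhdsWithin_le_nhds
  have hev := (hc.eventually (isOpen_interior.mem_nhds hx)).and
    ((hc.eventually (hU.mem_nhds hxU)).and self_mem_nhdsWithin)
  obtain ⟨t, ht1, ht2, ht3⟩ := Filter.Eventually.exists (f := 𝓝[>] (0 : ℝ)) hev
  have ht3 : 0 < t := ht3
  have hin : ⟪e, x + t • e⟫ = ⟪e, x⟫ + t := by
    rw [inner_add_right, inner_smul_right, real_inner_self_eq_norm_sq, he]
    ring
  have hpr : x + t • e - ⟪e, x + t • e⟫ • e = x - ⟪e, x⟫ • e := by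
    rw [hin, add_smul]
    abel
  have hmem : x + t • e ∈ interior Ω ∪ frontier Ω := by
    rw [← closure_eq_interior_union_frontier]
    exact interior_subset ht1
  rcases hmem with hm | hm
  · have := (hy _ ht2).1.1 hm
    rw [hpr, hin, ← h0] at this
    linarith
  · have := (hy _ ht2).2.1 hm
    rw [hpr, hin, ← h0] at this
    linarith

/-! ### Elements of a polytopal mesh -/

namespace PolytopalMesh

variable {d : ℕ} {Ω : Set (Eu d)} {ι Φ : Type*} [Fintype ι] [Fintype Φ]
  (M : PolytopalMesh d Ω ι Φ)

theorem mem_simplices {K : ι} {κ : Finset (Eu d)} (h : κ ∈ M.submesh K) : κ ∈ M.simplices :=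
  (M.submesh_cover κ).2 ⟨K, h⟩

theorem mem_elem {K : ι} {x : Eu d} :
    x ∈ M.elem K ↔ ∃ κ ∈ M.submesh K, x ∈ convexHull ℝ (κ : Set (Eu d)) :=
  mem_simplexUnion

theorem convexHull_subset_elem {K : ι} {κ : Finset (Eu d)} (h : κ ∈ M.submesh K) :
    convexHull ℝ (κ : Set (Eu d)) ⊆ M.elem K :=
  fun _ hx => M.mem_elem.2 ⟨κ, h, hx⟩

theorem isCompact_elem (K : ι) : IsCompact (M.elem K) := isCompact_simplexUnion _

theorem isClosed_elem (K : ι) : IsClosed (M.elem K) := (M.isCompact_elem K).isClosed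

theorem elem_subset_closure (K : ι) : M.elem K ⊆ closure Ω := fun x hx => by
  obtain ⟨κ, hκ, hx⟩ := M.mem_elem.1 hx
  exact M.convexHull_subset_closure (M.mem_simplices hκ) hx

theorem closure_eq_iUnion_elem : closure Ω = ⋃ K, M.elem K := by
  refine Subset.antisymm (fun x hx => ?_) (iUnion_subset M.elem_subset_closure)
  rw [← M.union_eq] at hx
  obtain ⟨κ, hκ, hx⟩ := mem_simplexUnion.1 hx
  obtain ⟨K, hK⟩ := (M.submesh_cover κ).1 hκ
  exact mem_iUnion.2 ⟨K, M.convexHull_subset_elem hK hx⟩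

theorem aedisjoint_elem {K L : ι} (h : K ≠ L) :
    AEDisjoint volume (M.elem K) (M.elem L) := by
  refine measure_mono_null (t := ⋃ κ ∈ M.submesh K, frontier (convexHull ℝ (κ : Set (Eu d))))
    (fun x hx => ?_) ((measure_biUnion_null_iff (M.submesh K).countable_toSet).2 fun κ _ =>
      SimplicialMesh.volume_frontier_convexHull κ)
  obtain ⟨κ, hκ, hxκ⟩ := M.mem_elem.1 hx.1
  obtain ⟨κ', hκ', hxκ'⟩ := M.mem_elem.1 hx.2
  refine mem_iUnion₂.2 ⟨κ, hκ, subset_closure hxκ, fun hxi => ?_⟩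
  have := M.eq_of_mem_interior (M.mem_simplices hκ) (M.mem_simplices hκ') hxi hxκ'
  subst this
  exact Finset.disjoint_left.1 (M.submesh_disjoint K L h) hκ hκ'

theorem elem_ae_eq_iUnion_interior (K : ι) :
    M.elem K =ᵐ[volume] ⋃ κ ∈ M.submesh K, interior (convexHull ℝ (κ : Set (Eu d))) :=
  Filter.EventuallyEq.countable_bUnion (M.submesh K).countable_toSet
    fun κ _ => SimplicialMesh.convexHull_ae_eq_interior κ

theorem interior_elem_ae_eq (K : ι) : interior (M.elem K) =ᵐ[volume] M.elem K := by
  refine (LE.le.eventuallyLE interior_subset).antisymm ?_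
  refine (M.elem_ae_eq_iUnion_interior K).le.trans (LE.le.eventuallyLE ?_)
  exact iUnion₂_subset fun κ hκ => interior_mono (M.convexHull_subset_elem hκ)

/-- Element interiors lie in the interior of `closure Ω`, which is `Ω` for a Lipschitz domain; this
avoids any direct estimate of the measure of `∂Ω`. -/
theorem domain_ae_eq_iUnion_elem (hΩ : IsOpen Ω) (hL : HasLipschitzBoundary Ω) :
    Ω =ᵐ[volume] ⋃ K, M.elem K := by
  rw [← M.closure_eq_iUnion_elem]
  refine (LE.le.eventuallyLE subset_closure).antisymm ?_
  rw [M.closure_eq_iUnion_elem]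
  refine (Filter.EventuallyEq.countable_iUnion fun K => (M.interior_elem_ae_eq K).symm).le.trans
    (LE.le.eventuallyLE ?_)
  refine iUnion_subset fun K => ?_
  exact (interior_mono (M.elem_subset_closure K)).trans (hL.interior_closure hΩ).subset

theorem elemMeasure_pos (K : ι) : 0 < M.elemMeasure K := by
  obtain ⟨κ, hκ⟩ := M.submesh_nonempty K
  have : 0 < volume (M.elem K) :=
    (isOpen_interior.measure_pos volume
      (M.interior_convexHull_nonempty (M.mem_simplices hκ))).trans_le
      (measure_mono (interior_subset.trans (M.convexHull_subset_elem hκ)))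
  exact ENNReal.toReal_pos this.ne' (M.isCompact_elem K).measure_lt_top.ne

theorem disjoint_of_isOpen {K L : ι} (h : K ≠ L) {O : Set (Eu d)} (hO : IsOpen O)
    (hK : O ⊆ M.elem K) (hL : O ⊆ M.elem L) : O = ∅ := by
  by_contra hne
  exact (hO.measure_pos volume (nonempty_iff_ne_empty.2 hne)).ne'
    (measure_mono_null (subset_inter hK hL) (M.aedisjoint_elem h))

/-- A point of `L` is a limit of interior points of a simplex of `L`. Were it interior to `K`, some
nonempty open set would lie in both elements, which overlap only in a null set. -/
theorem inter_elem_subset_frontier {K L : ι} (h : K ≠ L) :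
    M.elem K ∩ M.elem L ⊆ frontier (M.elem K) := by
  rintro x ⟨hxK, hxL⟩
  refine ⟨subset_closure hxK, fun hx => ?_⟩
  obtain ⟨κ, hκ, hxκ⟩ := M.mem_elem.1 hxL
  obtain ⟨y, hy⟩ := mem_closure_iff.1
    (M.convexHull_subset_closure_interior (M.mem_simplices hκ) hxκ) _ isOpen_interior hx
  have := M.disjoint_of_isOpen h (isOpen_interior.inter isOpen_interior)
    (inter_subset_left.trans interior_subset)
    (inter_subset_right.trans (interior_subset.trans (M.convexHull_subset_elem hκ)))
  rw [this] at hy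
  exact hy

end PolytopalMesh

/-! ### Facets, face normals and orientation signs -/

/-! ### Facets of a simplicial mesh -/

theorem mem_facets {d : ℕ} {S : Finset (Finset (Eu d))} {τ : Finset (Eu d)} :
    τ ∈ facets S ↔ ∃ κ ∈ S, τ ⊆ κ ∧ τ.card = d := by
  simp [facets, Finset.mem_powersetCard]

/-- The witness is the barycentre of `τ`: its weights are positive exactly on `τ`, so a facet that
contains it has all the vertices of `τ`, and both have `d` vertices. -/
theorem SimplicialMesh.eq_of_convexHull_subset {d : ℕ} {Ω : Set (Eu d)} (M : SimplicialMesh d Ω)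
    (hd : 1 ≤ d) {τ : Finset (Eu d)} (hτ : τ ∈ facets M.simplices) :
    ∃ x ∈ convexHull ℝ (τ : Set (Eu d)), ∀ τ' ∈ facets M.simplices,
      x ∈ convexHull ℝ (τ' : Set (Eu d)) → τ = τ' := by
  classical
  obtain ⟨κ, hκ, hτκ, hc⟩ := mem_facets.1 hτ
  have hd0 : (0 : ℝ) < d := by exact_mod_cast hd
  let w : Eu d → ℝ := fun b => if b ∈ τ then (d : ℝ)⁻¹ else 0
  have hw : IsBarycentric τ (∑ b ∈ τ, w b • b) w := by
    refine ⟨fun b hb => ?_, ?_, rfl, fun b hb => if_neg hb⟩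
    · simp only [w, if_pos hb]
      positivity
    · rw [Finset.sum_congr rfl fun b hb => if_pos hb, Finset.sum_const, hc, nsmul_eq_mul,
        mul_inv_cancel₀ hd0.ne']
  refine ⟨_, hw.mem_convexHull, fun τ' hτ' hx => ?_⟩
  obtain ⟨κ', hκ', hτκ', hc'⟩ := mem_facets.1 hτ'
  obtain ⟨w', hw'⟩ := exists_isBarycentric hx
  have := M.isBarycentric_unique hκ hκ' (hw.mono hτκ) (hw'.mono hτκ')
  refine Finset.eq_of_subset_of_card_le (fun b hb => ?_) (by rw [hc, hc'])
  by_contra hb'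
  have h0 := hw'.zero b hb'
  rw [← this] at h0
  simp only [w, if_pos hb] at h0
  exact (inv_pos.2 hd0).ne' h0

theorem intrinsicInterior_mono_of_affineSpan_eq {d : ℕ} {s t : Set (Eu d)} (hst : s ⊆ t)
    (h : affineSpan ℝ s = affineSpan ℝ t) : intrinsicInterior ℝ s ⊆ intrinsicInterior ℝ t := by
  -- The intrinsic interior is taken inside the affine span; naming the span by a variable `A` puts
  -- both sets in the same ambient subspace.
  have key : ∀ (u : Set (Eu d)) (A : AffineSubspace ℝ (Eu d)), affineSpan ℝ u = A →
      intrinsicInterior ℝ u = ((↑) : A → Eu d) '' interior (((↑) : A → Eu d) ⁻¹' u) := by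
    rintro u A rfl
    rfl
  rw [key s _ h, key t _ rfl]
  exact image_mono (interior_mono (preimage_mono hst))

namespace PolytopalMesh

variable {d : ℕ} {Ω : Set (Eu d)} {ι Φ : Type*} [Fintype ι] [Fintype Φ]
  (M : PolytopalMesh d Ω ι Φ)

theorem mem_elemFaces {K : ι} {σ : Φ} :
    σ ∈ M.elemFaces K ↔ M.face σ ⊆ frontier (M.elem K) := by
  simp [elemFaces]

theorem exists_facet_subset_face (σ : Φ) : ∃ τ ∈ facets M.simplices,
    convexHull ℝ (τ : Set (Eu d)) ⊆ M.face σ := by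
  obtain ⟨x, hx⟩ := M.face_nonempty σ
  rw [M.face_eq σ] at hx
  obtain ⟨τ, hτ, -⟩ := mem_iUnion₂.1 hx
  exact ⟨τ, hτ⟩

/-- The `d` affinely independent vertices span a direction of dimension `d - 1` inside the
hyperplane orthogonal to the normal, so the two coincide. -/
theorem vectorSpan_facet (hd : 1 ≤ d) {τ : Finset (Eu d)} (hτ : τ ∈ facets M.simplices) {σ : Φ}
    (h : convexHull ℝ (τ : Set (Eu d)) ⊆ M.face σ) :
    vectorSpan ℝ (τ : Set (Eu d)) = (ℝ ∙ M.normal σ)ᗮ := by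
  obtain ⟨κ, hκ, hτκ, hc⟩ := mem_facets.1 hτ
  have hn : M.normal σ ≠ 0 := fun h0 => by
    have := M.normal_norm σ
    rw [h0, norm_zero] at this
    exact zero_ne_one this
  refine Submodule.eq_of_le_of_finrank_eq ?_ ?_
  · rw [vectorSpan_def, Submodule.span_le]
    rintro _ ⟨x, hx, y, hy, rfl⟩
    exact Submodule.mem_orthogonal_singleton_iff_inner_right.2
      (M.normal_orthogonal σ x (h (subset_convexHull ℝ _ hx)) y (h (subset_convexHull ℝ _ hy)))
  · have hi : AffineIndependent ℝ ((↑) : τ → Eu d) :=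
      (M.affineIndependent κ hκ).mono (t := (κ : Set (Eu d))) (Finset.coe_subset.2 hτκ)
    have h1 := hi.finrank_vectorSpan (n := d - 1) (by
      rw [Fintype.card_coe, hc]
      omega)
    rw [Subtype.range_coe_subtype] at h1
    have h2 := Submodule.finrank_add_finrank_orthogonal (ℝ ∙ M.normal σ)
    rw [finrank_span_singleton hn, finrank_euclideanSpace_fin] at h2
    have h1' : Module.finrank ℝ (vectorSpan ℝ (τ : Set (Eu d))) = d - 1 := h1
    omega

theorem vectorSpan_face (hd : 1 ≤ d) (σ : Φ) :
    vectorSpan ℝ (M.face σ) = (ℝ ∙ M.normal σ)ᗮ := by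
  obtain ⟨τ, hτ, h⟩ := M.exists_facet_subset_face σ
  refine le_antisymm ?_ ?_
  · rw [vectorSpan_def, Submodule.span_le]
    rintro _ ⟨x, hx, y, hy, rfl⟩
    exact Submodule.mem_orthogonal_singleton_iff_inner_right.2 (M.normal_orthogonal σ x hx y hy)
  · rw [← M.vectorSpan_facet hd hτ h]
    exact vectorSpan_mono ℝ ((subset_convexHull ℝ _).trans h)

/-- A facet in the face has the same affine span, and its convex hull has intrinsic interior points.
Such a point is needed to use the outward condition on normals. -/
theorem intrinsicInterior_face_nonempty (hd : 1 ≤ d) (σ : Φ) :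
    (intrinsicInterior ℝ (M.face σ)).Nonempty := by
  obtain ⟨τ, hτ, h⟩ := M.exists_facet_subset_face σ
  obtain ⟨κ, hκ, hτκ, hc⟩ := mem_facets.1 hτ
  have hne : (τ : Set (Eu d)).Nonempty := by
    rw [Finset.coe_nonempty, ← Finset.card_pos]
    omega
  obtain ⟨x, hx⟩ := Set.Nonempty.intrinsicInterior (convex_convexHull ℝ (τ : Set (Eu d)))
    hne.convexHull
  refine ⟨x, intrinsicInterior_mono_of_affineSpan_eq h ?_ hx⟩
  refine AffineSubspace.eq_of_direction_eq_of_nonempty_of_le ?_ ?_ (affineSpan_mono ℝ h)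
  · rw [affineSpan_convexHull, direction_affineSpan, direction_affineSpan,
      M.vectorSpan_face hd, M.vectorSpan_facet hd hτ h]
  · rw [affineSpan_convexHull]
    exact (affineSpan_nonempty ℝ).2 hne

/-- Being orthogonal to the direction of the face, `n` lies on the line of `M.normal σ`; both are
unit vectors. -/
theorem outNormal_eq_sgn_smul (hd : 1 ≤ d) {σ : Φ} {S : Set (Eu d)} {n : Eu d}
    (h : IsOutwardNormal S (M.face σ) n) :
    n = ⟪n, M.normal σ⟫ • M.normal σ ∧ (⟪n, M.normal σ⟫ = 1 ∨ ⟪n, M.normal σ⟫ = -1) := by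
  have hmem : n ∈ ((ℝ ∙ M.normal σ)ᗮ)ᗮ := by
    rw [← M.vectorSpan_face hd σ, Submodule.mem_orthogonal', vectorSpan_def]
    intro u hu
    induction hu using Submodule.span_induction with
    | mem u hu =>
      obtain ⟨x, hx, y, hy, rfl⟩ := hu
      exact h.orthogonal x hx y hy
    | zero => exact inner_zero_right _
    | add u v _ _ hu hv => rw [inner_add_right, hu, hv, add_zero]
    | smul a u _ hu => rw [inner_smul_right, hu, mul_zero]
  rw [Submodule.orthogonal_orthogonal] at hmem
  obtain ⟨c, rfl⟩ := Submodule.mem_span_singleton.1 hmem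
  have hc : ⟪c • M.normal σ, M.normal σ⟫ = c := by
    rw [real_inner_smul_left, real_inner_self_eq_norm_sq, M.normal_norm σ, one_pow, mul_one]
  rw [hc]
  refine ⟨rfl, ?_⟩
  have := h.norm_eq
  rw [norm_smul, M.normal_norm σ, mul_one, Real.norm_eq_abs] at this
  exact eq_or_eq_neg_of_abs_eq this

theorem isOutwardNormal {K : ι} {σ : Φ} (h : σ ∈ M.elemFaces K) :
    IsOutwardNormal (M.elem K) (M.face σ) (M.outNormal K σ) :=
  M.outNormal_spec K σ (M.mem_elemFaces.1 h)

theorem sgn_eq_one_or {K : ι} {σ : Φ} (hd : 1 ≤ d) (h : σ ∈ M.elemFaces K) :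
    M.sgn K σ = 1 ∨ M.sgn K σ = -1 :=
  (M.outNormal_eq_sgn_smul hd (M.isOutwardNormal h)).2

theorem sgn_ne_zero {K : ι} {σ : Φ} (hd : 1 ≤ d) (h : σ ∈ M.elemFaces K) : M.sgn K σ ≠ 0 := by
  rcases M.sgn_eq_one_or hd h with h | h <;> rw [h] <;> norm_num

/-- Equal signs mean equal outward normals. Stepping back along this normal from an intrinsic
interior point of the face enters the interiors of both elements, which are disjoint if `K ≠ L`.
Hence at most two elements share a face. -/
theorem eq_of_sgn_eq {K L : ι} {σ : Φ} (hd : 1 ≤ d) (hK : σ ∈ M.elemFaces K)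
    (hL : σ ∈ M.elemFaces L) (h : M.sgn K σ = M.sgn L σ) : K = L := by
  by_contra hne
  have hn : M.outNormal K σ = M.outNormal L σ := by
    rw [(M.outNormal_eq_sgn_smul hd (M.isOutwardNormal hK)).1,
      (M.outNormal_eq_sgn_smul hd (M.isOutwardNormal hL)).1]
    exact congrArg (· • M.normal σ) h
  obtain ⟨x, hx⟩ := M.intrinsicInterior_face_nonempty hd σ
  obtain ⟨t, ⟨h1, -⟩, h2, -⟩ := Filter.Eventually.exists (f := 𝓝[>] (0 : ℝ))
    (((M.isOutwardNormal hK).outward x hx).and ((M.isOutwardNormal hL).outward x hx))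
  rw [← hn] at h2
  have := M.disjoint_of_isOpen hne (isOpen_interior.inter isOpen_interior)
    (inter_subset_left.trans interior_subset) (inter_subset_right.trans interior_subset)
  exact (this ▸ ⟨h1, h2⟩ : x - t • M.outNormal K σ ∈ (∅ : Set (Eu d)))

theorem sgn_eq_neg {K L : ι} {σ : Φ} (hd : 1 ≤ d) (hK : σ ∈ M.elemFaces K)
    (hL : σ ∈ M.elemFaces L) (h : K ≠ L) : M.sgn L σ = - M.sgn K σ := by
  have hne : M.sgn K σ ≠ M.sgn L σ := fun h' => h (M.eq_of_sgn_eq hd hK hL h')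
  rcases M.sgn_eq_one_or hd hK with h1 | h1 <;> rcases M.sgn_eq_one_or hd hL with h2 | h2 <;>
    simp_all

open Classical in
/-- A sum over the elements which share a face has only two terms, with opposite signs. -/
theorem sum_sgn_mul {K L : ι} {σ : Φ} (hd : 1 ≤ d) (hK : σ ∈ M.elemFaces K)
    (hL : σ ∈ M.elemFaces L) (h : K ≠ L) (c : ι → ℝ) :
    ∑ N, (if σ ∈ M.elemFaces N then M.sgn N σ * c N else 0) = M.sgn K σ * (c K - c L) := by
  rw [← Finset.sum_subset (Finset.subset_univ {K, L}), Finset.sum_pair h, if_pos hK, if_pos hL,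
    M.sgn_eq_neg hd hK hL h]
  · ring
  · intro N _ hN
    refine if_neg fun hN' => ?_
    simp only [Finset.mem_insert, Finset.mem_singleton, not_or] at hN
    refine hN.2 (M.eq_of_sgn_eq hd hN' hL ?_)
    rw [M.sgn_eq_neg hd hK hL h, M.sgn_eq_neg hd hK hN' (Ne.symm hN.1)]

open Classical in
theorem sum_sgn_eq_zero_or (hd : 1 ≤ d) (σ : Φ) :
    ∑ K, (if σ ∈ M.elemFaces K then M.sgn K σ else 0) = 0 ∨ M.face σ ⊆ frontier Ω := by
  rcases M.face_interior_or_boundary σ with ⟨K, L, h, hσ⟩ | ⟨K, hσ⟩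
  · left
    have hK : σ ∈ M.elemFaces K :=
      M.mem_elemFaces.2 (hσ.trans (M.inter_elem_subset_frontier h))
    have hL : σ ∈ M.elemFaces L := by
      refine M.mem_elemFaces.2 (hσ.trans ?_)
      rw [inter_comm]
      exact M.inter_elem_subset_frontier h.symm
    simpa using M.sum_sgn_mul hd hK hL h fun _ => 1
  · right
    exact hσ.trans inter_subset_right

theorem parent_spec {K : ι} (τ : M.extSubfaces K) :
    convexHull ℝ ((τ : Finset (Eu d)) : Set (Eu d)) ⊆ M.face (M.parent K τ) :=
  (M.exists_parent τ.2).choose_spec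

/-- The barycentre of `τ` lies in some face of `K`, hence in a facet contained in that face. This
facet must be `τ`, and `τ` has only one parent face. -/
theorem mem_elemFaces_of_facet (hd : 1 ≤ d) {K : ι} {τ : Finset (Eu d)}
    (hτ : τ ∈ facets M.simplices) {σ : Φ} (hσ : convexHull ℝ (τ : Set (Eu d)) ⊆ M.face σ)
    (h : convexHull ℝ (τ : Set (Eu d)) ⊆ frontier (M.elem K)) : σ ∈ M.elemFaces K := by
  obtain ⟨x, hx, hu⟩ := M.eq_of_convexHull_subset hd hτ
  have hxf := h hx
  rw [elem, M.frontier_eq K] at hxf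
  obtain ⟨σ', hσ', hxσ'⟩ := mem_iUnion₂.1 hxf
  rw [M.face_eq σ'] at hxσ'
  obtain ⟨τ', ⟨hτ', hτσ'⟩, hxτ'⟩ := mem_iUnion₂.1 hxσ'
  have := hu τ' hτ' hxτ'
  subst this
  rw [M.face_unique τ hτ σ σ' hσ hτσ']
  exact M.mem_elemFaces.2 hσ'

end PolytopalMesh

/-! ### Integrals over the domain and over the elements -/

theorem integrable_inner_of_memLp {α E : Type*} [MeasurableSpace α] [NormedAddCommGroup E]
    [InnerProductSpace ℝ E] {μ : Measure α} {u v : α → E} (hu : MemLp u 2 μ) (hv : MemLp v 2 μ) :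
    Integrable (fun x => ⟪u x, v x⟫) μ :=
  (MemLp.integrable_mul hu.norm hv.norm).mono
    (hu.aestronglyMeasurable.inner hv.aestronglyMeasurable)
    (Eventually.of_forall fun x => by
      simpa using norm_inner_le_norm (𝕜 := ℝ) (u x) (v x))

theorem continuous_gradient {d : ℕ} {φ : Eu d → ℝ} (h : ContDiff ℝ ∞ φ) :
    Continuous (gradient φ) :=
  (InnerProductSpace.toDual ℝ (Eu d)).symm.continuous.comp (h.continuous_fderiv (by simp))

theorem hasCompactSupport_gradient {d : ℕ} {φ : Eu d → ℝ} (h : HasCompactSupport φ) :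
    HasCompactSupport (gradient φ) :=
  (h.fderiv ℝ).comp_left (map_zero _)

theorem IsTestFunction.memLp_gradient {d : ℕ} {Ω : Set (Eu d)} {φ : Eu d → ℝ}
    (h : IsTestFunction Ω φ) (μ : Measure (Eu d)) [IsFiniteMeasureOnCompacts μ] :
    MemLp (gradient φ) 2 μ :=
  (continuous_gradient h.smooth).memLp_of_hasCompactSupport (hasCompactSupport_gradient h.compact)

theorem IsTestFunction.memLp {d : ℕ} {Ω : Set (Eu d)} {φ : Eu d → ℝ}
    (h : IsTestFunction Ω φ) (μ : Measure (Eu d)) [IsFiniteMeasureOnCompacts μ] :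
    MemLp φ 2 μ :=
  h.smooth.continuous.memLp_of_hasCompactSupport h.compact

namespace PolytopalMesh

variable {d : ℕ} {Ω : Set (Eu d)} {ι Φ : Type*} [Fintype ι] [Fintype Φ]
  (M : PolytopalMesh d Ω ι Φ)

theorem restrict_interior_elem (K : ι) :
    volume.restrict (interior (M.elem K)) = volume.restrict (M.elem K) :=
  Measure.restrict_congr_set (M.interior_elem_ae_eq K)

theorem restrict_domain (hΩ : IsOpen Ω) (hL : HasLipschitzBoundary Ω) :
    volume.restrict Ω = volume.restrict (⋃ K, M.elem K) :=
  Measure.restrict_congr_set (M.domain_ae_eq_iUnion_elem hΩ hL)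

theorem integrableOn_domain_iff (hΩ : IsOpen Ω) (hL : HasLipschitzBoundary Ω)
    {E : Type*} [NormedAddCommGroup E] {F : Eu d → E} :
    IntegrableOn F Ω ↔ ∀ K, IntegrableOn F (M.elem K) := by
  rw [IntegrableOn, M.restrict_domain hΩ hL]
  exact integrableOn_finite_iUnion

theorem setIntegral_domain (hΩ : IsOpen Ω) (hL : HasLipschitzBoundary Ω)
    {F : Eu d → ℝ} (hF : IntegrableOn F Ω) :
    ∫ x in Ω, F x = ∑ K, ∫ x in M.elem K, F x := by
  rw [IntegrableOn, M.restrict_domain hΩ hL] at hF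
  rw [M.restrict_domain hΩ hL, integral_iUnion_ae
    (fun K => (M.isClosed_elem K).measurableSet.nullMeasurableSet)
    (fun K L h => M.aedisjoint_elem h) hF, tsum_fintype]

theorem memLp_domain (hΩ : IsOpen Ω) (hL : HasLipschitzBoundary Ω)
    {E : Type*} [NormedAddCommGroup E] {F : Eu d → E}
    (h : ∀ K, MemLp F 2 (volume.restrict (M.elem K))) : MemLp F 2 (volume.restrict Ω) := by
  have hm : AEStronglyMeasurable F (volume.restrict Ω) := by
    rw [M.restrict_domain hΩ hL, aestronglyMeasurable_iUnion_iff]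
    exact fun K => (h K).aestronglyMeasurable
  rw [memLp_two_iff_integrable_sq_norm hm]
  exact (M.integrableOn_domain_iff hΩ hL).2 fun K =>
    (memLp_two_iff_integrable_sq_norm (h K).aestronglyMeasurable).1 (h K)

theorem ae_domain (hΩ : IsOpen Ω) (hL : HasLipschitzBoundary Ω) :
    ∀ᵐ x ∂volume.restrict Ω, ∃ K, x ∈ interior (M.elem K) := by
  rw [M.restrict_domain hΩ hL, ae_restrict_iUnion_iff]
  intro K
  rw [← M.restrict_interior_elem K]
  exact (ae_restrict_mem isOpen_interior.measurableSet).mono fun x hx => ⟨K, hx⟩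

open Classical in
/-- Face contributions cancel between neighbouring elements, if they vanish on the boundary. -/
theorem sum_sum_sgn_mul_eq_zero (hd : 1 ≤ d) (c : Φ → ℝ)
    (hc : ∀ σ, M.face σ ⊆ frontier Ω → c σ = 0) :
    ∑ K, ∑ σ ∈ M.elemFaces K, M.sgn K σ * c σ = 0 := by
  have : ∀ K, ∑ σ ∈ M.elemFaces K, M.sgn K σ * c σ =
      ∑ σ, (if σ ∈ M.elemFaces K then M.sgn K σ else 0) * c σ := fun K => by
    simp [ite_mul, Finset.sum_ite_mem]
  simp only [this]
  rw [Finset.sum_comm]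
  refine Finset.sum_eq_zero fun σ _ => ?_
  rw [← Finset.sum_mul]
  rcases M.sum_sgn_eq_zero_or hd σ with h | h
  · rw [h, zero_mul]
  · rw [hc σ h, mul_zero]

end PolytopalMesh

/-! ### Interelement cancellation: divergence of the lifting, multipliers, boundary fluxes -/

namespace SaddlePointScheme

variable {d : ℕ} {Ω : Set (Eu d)} {ι Φ : Type*} [Fintype ι] [Fintype Φ]
  {M : PolytopalMesh d Ω ι Φ} {f : Eu d → ℝ}

/-- Summing the element Green formulas leaves face integrals of one common density with opposite
signs; on faces in `∂Ω` the test function vanishes. -/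
theorem IsLifting.hasWeakDivergence {S : SaddlePointScheme M f} (hd : 1 ≤ d) (hΩ : IsOpen Ω)
    (hL : HasLipschitzBoundary Ω) {Km : Eu d → Matrix (Fin d) (Fin d) ℝ} {ut : Eu d → Eu d}
    (h : S.IsLifting Km ut) : HasWeakDivergence Ω ut f := by
  have hu : MemLp ut 2 (volume.restrict Ω) := M.memLp_domain hΩ hL fun K => by
    rw [← M.restrict_interior_elem K]
    exact (h.divergence K).memLp
  have hf : MemLp f 2 (volume.restrict Ω) := M.memLp_domain hΩ hL fun K => by
    rw [← M.restrict_interior_elem K]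
    exact (h.divergence K).memLp_div
  refine ⟨hu, hf, fun φ hφ => ?_⟩
  have h1 := integrable_inner_of_memLp hu (hφ.memLp_gradient _)
  have h2 : Integrable (fun x => f x * φ x) (volume.restrict Ω) :=
    MemLp.integrable_mul hf (hφ.memLp _)
  have h3 : IntegrableOn (fun x => ⟪ut x, gradient φ x⟫ + f x * φ x) Ω := h1.add h2
  rw [eq_neg_iff_add_eq_zero, ← integral_add h1 h2, M.setIntegral_domain hΩ hL h3]
  obtain ⟨g, -, hg, -⟩ := h.normalFlux
  simp only [hg _ φ hφ.smooth hφ.compact]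
  refine M.sum_sum_sgn_mul_eq_zero hd (fun σ => ∫ x in M.face σ, g σ x * φ x ∂μHE[d - 1])
    fun σ hσ => setIntegral_eq_zero_of_forall_eq_zero fun x hx => ?_
  have : φ x = 0 := by
    by_contra hne
    have hxΩ := hφ.support (subset_tsupport φ hne)
    have := hσ hx
    rw [hΩ.frontier_eq] at this
    exact this.2 hxΩ
  rw [this, mul_zero]

open Classical in
-- This is row `σ` of `A U + Bᵗ P = 0`, regrouped by elements: the factor `s_{Kσ}` comes out of both
-- the assembled matrix and `Bᵗ`, leaving minus the element multiplier.
theorem sum_sgn_mul_elemMultiplier (S : SaddlePointScheme M f) (σ : Φ) :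
    ∑ K, (if σ ∈ M.elemFaces K then
      M.sgn K σ * (if h : σ ∈ M.elemFaces K then S.elemMultiplier K ⟨σ, h⟩ else 0) else 0) = 0 := by
  have h := congrFun S.system (Sum.inl σ)
  rw [Matrix.fromBlocks_mulVec] at h
  simp only [Sum.elim_inl, Pi.add_apply, Pi.zero_apply, Sum.elim_comp_inl, Sum.elim_comp_inr,
    Matrix.mulVec, dotProduct, Matrix.transpose_apply, PolytopalMesh.assembleA,
    PolytopalMesh.matB, Finset.sum_mul] at h
  rw [Finset.sum_comm, ← Finset.sum_add_distrib] at h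
  rw [← neg_eq_zero, ← Finset.sum_neg_distrib]
  refine Eq.trans (Finset.sum_congr rfl fun K _ => ?_) h
  by_cases hσ : σ ∈ M.elemFaces K
  · simp only [hσ, if_true, dif_pos, true_and, elemMultiplier]
    have : ∀ g : M.elemFaces K → ℝ, ∑ σ', (if h : σ' ∈ M.elemFaces K then g ⟨σ', h⟩ else 0) =
        ∑ σ' : M.elemFaces K, g σ' := fun g => by
      rw [← Finset.sum_subset (Finset.subset_univ (M.elemFaces K))
        (fun σ' _ h' => dif_neg h'), ← Finset.sum_coe_sort]
      exact Finset.sum_congr rfl fun σ' _ => dif_pos σ'.2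
    have h3 := this fun σ' =>
      M.sgn K σ * M.sgn K σ' * S.Ahat K ⟨σ, hσ⟩ σ' * S.U σ'
    have h4 : ∑ σ', (if h : σ' ∈ M.elemFaces K then
        M.sgn K σ * M.sgn K σ' * S.Ahat K ⟨σ, hσ⟩ ⟨σ', h⟩ else 0) * S.U σ' =
        M.sgn K σ * ∑ σ' : M.elemFaces K, M.sgn K σ' * S.Ahat K ⟨σ, hσ⟩ σ' * S.U σ' := by
      rw [Finset.mul_sum]
      simp only [dite_mul, zero_mul]
      rw [h3]
      exact Finset.sum_congr rfl fun σ' _ => by ring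
    rw [h4]
    ring
  · simp [hσ]

theorem elemMultiplier_eq (S : SaddlePointScheme M f) (hd : 1 ≤ d) {K L : ι} {σ : Φ}
    (hK : σ ∈ M.elemFaces K) (hL : σ ∈ M.elemFaces L) :
    S.elemMultiplier K ⟨σ, hK⟩ = S.elemMultiplier L ⟨σ, hL⟩ := by
  classical
  by_cases h : K = L
  · subst h
    rfl
  have h1 := M.sum_sgn_mul hd hK hL h
    fun N => if h : σ ∈ M.elemFaces N then S.elemMultiplier N ⟨σ, h⟩ else 0
  rw [S.sum_sgn_mul_elemMultiplier σ, dif_pos hK, dif_pos hL] at h1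
  exact sub_eq_zero.1 ((mul_eq_zero.1 h1.symm).resolve_left (M.sgn_ne_zero hd hK))

theorem multiplier_eq (S : SaddlePointScheme M f) (hd : 1 ≤ d) (K : ι) (σ : M.elemFaces K) :
    S.multiplier σ = S.elemMultiplier K σ := by
  have h : ∃ L, (σ : Φ) ∈ M.elemFaces L := ⟨K, σ.2⟩
  rw [multiplier, dif_pos h]
  exact S.elemMultiplier_eq hd _ σ.2

theorem pointValue_of_mem_frontier (S : SaddlePointScheme M f) {a : Eu d}
    (ha : a ∈ frontier Ω) : S.pointValue a = 0 :=
  if_pos ha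

theorem subfaceValue_of_subset_frontier (S : SaddlePointScheme M f) {τ : Finset (Eu d)}
    (h : convexHull ℝ (τ : Set (Eu d)) ⊆ frontier Ω) : S.subfaceValue τ = 0 := by
  rw [subfaceValue, Finset.sum_eq_zero, mul_zero]
  exact fun a ha => S.pointValue_of_mem_frontier (h (subset_convexHull ℝ _ ha))

theorem sum_extFlux_dotProduct_Zext (S : SaddlePointScheme M f) (hd : 1 ≤ d) :
    ∑ K, S.extFlux K ⬝ᵥ S.Zext K = 0 := by
  classical
  -- The contribution of the subface `τ` to the face `σ`, stripped of its sign, does not depend on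
  -- the element. Each exterior subface is counted once, through its unique parent.
  let c : Φ → Finset (Eu d) → ℝ := fun σ τ =>
    if convexHull ℝ (τ : Set (Eu d)) ⊆ M.face σ then S.U σ / M.faceMeasure σ *
      (μHE[d - 1]).real (convexHull ℝ (τ : Set (Eu d))) * S.subfaceValue τ else 0
  rw [← M.sum_sum_sgn_mul_eq_zero hd (fun σ => ∑ τ ∈ facets M.simplices, c σ τ)
    fun σ hσ => Finset.sum_eq_zero fun τ _ => ?_]
  · refine Finset.sum_congr rfl fun K _ => ?_
    simp only [Finset.mul_sum]
    rw [Finset.sum_comm]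
    have hsub : M.extSubfaces K ⊆ facets M.simplices :=
      (Finset.filter_subset _ _).trans (Finset.filter_subset _ _)
    rw [← Finset.sum_subset hsub fun τ hτ hτK => ?_, ← Finset.sum_coe_sort, dotProduct]
    · refine Finset.sum_congr rfl fun τ _ => ?_
      have hτ := hsub τ.2
      have hp := M.parent_spec τ
      rw [Finset.sum_eq_single (M.parent K τ)]
      · simp only [c, if_pos hp, extFlux, Zext]
        ring
      · intro σ _ hσ
        have : ¬ convexHull ℝ ((τ : Finset (Eu d)) : Set (Eu d)) ⊆ M.face σ :=
          fun h => hσ (M.face_unique τ hτ σ _ h hp)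
        simp only [c, if_neg this, mul_zero]
      · exact fun h => (h (M.mem_elemFaces_of_facet hd hτ hp (Finset.mem_filter.1 τ.2).2)).elim
    · refine Finset.sum_eq_zero fun σ hσ => ?_
      have : ¬ convexHull ℝ (τ : Set (Eu d)) ⊆ M.face σ := fun h => hτK
        (Finset.mem_filter.2 ⟨Finset.mem_filter.2 ⟨hτ, σ, h⟩, h.trans (M.mem_elemFaces.1 hσ)⟩)
      simp only [c, if_neg this, mul_zero]
  · by_cases h : convexHull ℝ (τ : Set (Eu d)) ⊆ M.face σ
    · simp only [c, if_pos h, S.subfaceValue_of_subset_frontier (h.trans hσ), mul_zero]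
    · simp only [c, if_neg h]

end SaddlePointScheme

/-! ### Lipschitz functions in `H¹₀` -/

theorem gradient_apply {d : ℕ} (φ : Eu d → ℝ) (x : Eu d) (i : Fin d) :
    gradient φ x i = fderiv ℝ φ x (EuclideanSpace.single i 1) := by
  rw [← inner_gradient_left, EuclideanSpace.inner_single_right]
  simp

theorem norm_gradient {d : ℕ} (φ : Eu d → ℝ) (x : Eu d) : ‖gradient φ x‖ = ‖fderiv ℝ φ x‖ :=
  (InnerProductSpace.toDual ℝ (Eu d)).symm.norm_map _

theorem measurable_gradient {d : ℕ} (φ : Eu d → ℝ) : Measurable (gradient φ) :=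
  (InnerProductSpace.toDual ℝ (Eu d)).symm.continuous.measurable.comp (measurable_fderiv ℝ φ)

/-- A uniformly bounded, almost everywhere convergent sequence converges in `L²`. -/
theorem tendsto_eLpNorm_two_of_bounded {α E : Type*} [MeasurableSpace α] [NormedAddCommGroup E]
    {μ : Measure α} [IsFiniteMeasure μ] {F : ℕ → α → E} {G : α → E} {C : ℝ}
    (hF : ∀ n, AEStronglyMeasurable (F n) μ) (hG : MemLp G 2 μ) (hC : ∀ n x, ‖F n x‖ ≤ C)
    (h : ∀ᵐ x ∂μ, Tendsto (fun n => F n x) atTop (𝓝 (G x))) :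
    Tendsto (fun n => eLpNorm (fun x => F n x - G x) 2 μ) atTop (𝓝 0) := by
  refine tendsto_Lp_finite_of_tendsto_ae (by norm_num) (by norm_num) hF hG ?_ h
  intro ε hε
  -- Uniform integrability is inherited from the dominating constant `C`.
  obtain ⟨δ, hδ, hδ'⟩ := unifIntegrable_const (ι := Unit) (μ := μ) (p := 2) (g := fun _ => C)
    (by norm_num) (by norm_num) (memLp_const C) hε
  refine ⟨δ, hδ, fun n s hs hμ => (eLpNorm_mono fun x => ?_).trans (hδ' () s hs hμ)⟩
  by_cases hx : x ∈ s
  · simpa [indicator_of_mem hx] using (hC n x).trans (le_abs_self C)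
  · simp [indicator_of_notMem hx]

/-- A smooth truncation of the identity near zero. -/
theorem exists_smooth_truncation : ∃ T : ℝ → ℝ, ContDiff ℝ ∞ T ∧ (∀ t, |t| ≤ 1 → T t = 0) ∧
    (∀ t, 2 < |t| → deriv T t = 1) ∧ ∃ C, 0 ≤ C ∧ (∀ t, |deriv T t| ≤ C) ∧ ∀ t, |T t - t| ≤ C := by
  let b : ContDiffBump (0 : ℝ) := ⟨1, 2, one_pos, one_lt_two⟩
  -- The truncation is `t - t * b t`, with a bump `b` equal to one on `[-1, 1]` and zero outside
  -- `(-2, 2)`; the correction `B` and its derivative are bounded by compact support.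
  let B : ℝ → ℝ := fun t => t * b t
  have hB : ContDiff ℝ ∞ B := contDiff_id.mul b.contDiff
  have hBc : HasCompactSupport B := b.hasCompactSupport.mul_left
  have hBd : ∀ t, HasDerivAt (fun t => t - B t) (1 - deriv B t) t := fun t =>
    (hasDerivAt_id t).sub ((hB.differentiable (by simp)) t).hasDerivAt
  obtain ⟨C₁, hC₁⟩ := hB.continuous.bounded_above_of_compact_support hBc
  obtain ⟨C₂, hC₂⟩ := (hB.continuous_deriv (by simp)).bounded_above_of_compact_support hBc.deriv
  refine ⟨fun t => t - B t, contDiff_id.sub hB, fun t ht => ?_, fun t ht => ?_,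
    max C₁ (1 + C₂), ?_, fun t => ?_, fun t => ?_⟩
  · have : b t = 1 := b.one_of_mem_closedBall (by simpa [Real.norm_eq_abs] using ht)
    simp [B, this]
  · rw [(hBd t).deriv]
    have : B =ᶠ[𝓝 t] fun _ => 0 := by
      filter_upwards [(isOpen_lt continuous_const continuous_abs).mem_nhds ht] with y hy
      have : b y = 0 := b.zero_of_le_dist (by
        rw [Real.dist_eq, sub_zero]
        exact (show (2 : ℝ) < |y| from hy).le)
      simp [B, this]
    rw [this.deriv_eq, deriv_const, sub_zero]
  · exact ((norm_nonneg _).trans (hC₁ 0)).trans (le_max_left _ _)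
  · rw [(hBd t).deriv]
    refine ((abs_sub _ _).trans ?_).trans (le_max_right _ _)
    rw [abs_one]
    exact add_le_add_right (hC₂ t) 1
  · rw [sub_sub_cancel_left, abs_neg]
    exact (hC₁ t).trans (le_max_left _ _)

section Mollification

variable {d : ℕ} {s : Eu d → ℝ} {L : ℝ≥0} (hs : LipschitzWith L s) (ρ : ContDiffBump (0 : Eu d))
include hs

/-- The mollified derivative is an average, for a probability density, of functionals of norm at
most `L`. -/
theorem LipschitzWith.norm_fderiv_convolution_le (x : Eu d) :
    ‖(convolution (ρ.normed volume) (fderiv ℝ s) (ContinuousLinearMap.lsmul ℝ ℝ) volume) x‖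
      ≤ L := by
  have h1 : ∫ t, ρ.normed volume t * (L : ℝ) = L := by
    rw [integral_mul_const, ρ.integral_normed, one_mul]
  rw [← h1]
  refine norm_integral_le_of_norm_le (ρ.integrable_normed.mul_const _)
    (Eventually.of_forall fun t => ?_)
  rw [ContinuousLinearMap.lsmul_apply, norm_smul, Real.norm_eq_abs,
    abs_of_nonneg (ρ.nonneg_normed t)]
  exact mul_le_mul_of_nonneg_left (norm_fderiv_le_of_lipschitz ℝ hs) (ρ.nonneg_normed t)

/-- The derivative of the mollification of a Lipschitz function is the mollification of its
derivative. -/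
theorem LipschitzWith.hasFDerivAt_convolution (x : Eu d) :
    HasFDerivAt (convolution (ρ.normed volume) s (ContinuousLinearMap.lsmul ℝ ℝ) volume)
      ((convolution (ρ.normed volume) (fderiv ℝ s) (ContinuousLinearMap.lsmul ℝ ℝ) volume) x)
      x := by
  have hcont : ∀ y, Continuous fun t => ρ.normed volume t • s (y - t) := fun y =>
    ρ.continuous_normed.smul (hs.continuous.comp (by fun_prop))
  have hmeas : Measurable fun t => fderiv ℝ s (x - t) :=
    (measurable_fderiv ℝ s).comp (measurable_const.sub measurable_id)
  refine (hasFDerivAt_integral_of_dominated_loc_of_lip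
    (F := fun y t => ρ.normed volume t • s (y - t))
    (F' := fun t => ρ.normed volume t • fderiv ℝ s (x - t))
    (bound := fun t => ρ.normed volume t * L) (s := univ) univ_mem
    (Eventually.of_forall fun y => (hcont y).aestronglyMeasurable)
    ((hcont x).integrable_of_hasCompactSupport ρ.hasCompactSupport_normed.smul_right)
    (ρ.continuous_normed.aestronglyMeasurable.smul hmeas.aestronglyMeasurable)
    (Eventually.of_forall fun t => ?_) (ρ.integrable_normed.mul_const _) ?_).2
  · refine (LipschitzWith.of_dist_le_mul fun y z => ?_).lipschitzOnWith
    rw [dist_eq_norm, ← smul_sub, norm_smul, ← dist_eq_norm, Real.coe_nnabs,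
      abs_of_nonneg (mul_nonneg (ρ.nonneg_normed (μ := volume) t) L.coe_nonneg), Real.norm_eq_abs,
      abs_of_nonneg (ρ.nonneg_normed t), mul_assoc]
    refine mul_le_mul_of_nonneg_left ((hs.dist_le_mul _ _).trans ?_) (ρ.nonneg_normed t)
    rw [dist_sub_right]
  -- By Rademacher's theorem `s` is differentiable almost everywhere, and `t ↦ x - t` preserves null
  -- sets.
  · have hq : Measure.QuasiMeasurePreserving (fun t : Eu d => x - t) volume volume :=
      (Measure.measurePreserving_sub_left volume x).quasiMeasurePreserving
    filter_upwards [hq.ae hs.ae_differentiableAt] with t ht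
    have := ht.hasFDerivAt.comp x ((hasFDerivAt_id x).sub_const t)
    exact this.const_smul (ρ.normed volume t)

end Mollification

/-- The approximants are `ε T(u / ε)`, with `u` a mollification of `s` and `T` the truncation that
vanishes near zero. Mollifying alone would spread the support beyond `Ω`; the truncation removes the
region where `s` is small. No regularity of `∂Ω` is needed. The hypothesis `hz` identifies the limit
of the gradients where `s = 0`. -/
theorem LipschitzWith.isH10 {d : ℕ} {Ω : Set (Eu d)}
    (hb : Bornology.IsBounded Ω) {s : Eu d → ℝ} {L : ℝ≥0} (hs : LipschitzWith L s)
    (h0 : ∀ x ∉ Ω, s x = 0) (hz : ∀ᵐ x, s x = 0 → gradient s x = 0) :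
    IsH10 Ω s (gradient s) := by
  have hfin : IsFiniteMeasure (volume.restrict Ω) := ⟨by
    rw [Measure.restrict_apply_univ]
    exact hb.measure_lt_top⟩
  have hsupp : Function.support s ⊆ Ω := fun x hx => by_contra fun h => hx (h0 x h)
  have hsc : HasCompactSupport s :=
    HasCompactSupport.of_support_subset_isCompact hb.isCompact_closure
      (hsupp.trans subset_closure)
  have hbound : ∀ x, ‖gradient s x‖ ≤ L := fun x => by
    rw [norm_gradient]
    exact norm_fderiv_le_of_lipschitz ℝ hs
  have hmem : MemLp (gradient s) 2 (volume.restrict Ω) :=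
    MemLp.of_bound (measurable_gradient s).aestronglyMeasurable L (Eventually.of_forall hbound)
  refine ⟨⟨hs.continuous.memLp_of_hasCompactSupport hsc, hmem, fun φ hφ i => ?_⟩, ?_⟩
  · obtain ⟨D, hD⟩ := hφ.smooth.lipschitzWith_of_hasCompactSupport hφ.compact (by simp)
    have hφ0 : ∀ x ∉ Ω, φ x = 0 := fun x hx => by_contra fun h =>
      hx (hφ.support (subset_tsupport φ h))
    -- Integration by parts for a Lipschitz function, in the direction of the `i`-th basis vector.
    have key := integral_lineDeriv_mul_eq (μ := volume) hs hD hφ.compact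
      (EuclideanSpace.single i 1)
    rw [setIntegral_eq_integral_of_forall_compl_eq_zero fun x hx => by rw [h0 x hx, zero_mul],
      setIntegral_eq_integral_of_forall_compl_eq_zero fun x hx => by rw [hφ0 x hx, mul_zero]]
    have h1 : ∫ x, gradient s x i * φ x =
        ∫ x, lineDeriv ℝ s x (EuclideanSpace.single i 1) * φ x := by
      refine integral_congr_ae ?_
      filter_upwards [hs.ae_differentiableAt] with x hx
      rw [gradient_apply, hx.lineDeriv_eq_fderiv]
    rw [h1, key, ← integral_neg]
    refine integral_congr_ae (Eventually.of_forall fun x => ?_)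
    simp only [gradient_apply]
    rw [(hφ.smooth.differentiable (by simp) x).lineDeriv_eq_fderiv, map_neg]
    ring
  obtain ⟨T, hT, hT0, hT1, C, hC, hTd, hTC⟩ := exists_smooth_truncation
  let r : ℕ → ℝ := fun n => 1 / ((n : ℝ) + 1)
  have hr : ∀ n, 0 < r n := fun n => by positivity
  have hr0 : Tendsto r atTop (𝓝 0) := tendsto_one_div_add_atTop_nhds_zero_nat
  -- The threshold exceeds the mollification error `L * r n` by `(L + 1) * r n`, so `|u n x| > ε n`
  -- forces `|s x| ≥ (L + 1) * r n > 0`, a closed condition satisfied only in `Ω`.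
  let ε : ℕ → ℝ := fun n => (2 * L + 1) * r n
  have hε : ∀ n, 0 < ε n := fun n => by
    have := hr n
    positivity
  have hε0 : Tendsto ε atTop (𝓝 0) := by simpa using hr0.const_mul (2 * (L : ℝ) + 1)
  let ρ : ℕ → ContDiffBump (0 : Eu d) := fun n =>
    ⟨r n / 2, r n, half_pos (hr n), half_lt_self (hr n)⟩
  let u : ℕ → Eu d → ℝ := fun n =>
    convolution ((ρ n).normed volume) s (ContinuousLinearMap.lsmul ℝ ℝ) volume
  let du : ℕ → Eu d → (Eu d →L[ℝ] ℝ) := fun n =>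
    convolution ((ρ n).normed volume) (fderiv ℝ s) (ContinuousLinearMap.lsmul ℝ ℝ) volume
  have hu : ∀ n, ContDiff ℝ ∞ (u n) := fun n =>
    (ρ n).hasCompactSupport_normed.contDiff_convolution_left _ (ρ n).contDiff_normed
      hs.continuous.locallyIntegrable
  have hdu : ∀ n x, HasFDerivAt (u n) (du n x) x := fun n x => hs.hasFDerivAt_convolution (ρ n) x
  have hdub : ∀ n x, ‖du n x‖ ≤ L := fun n x => hs.norm_fderiv_convolution_le (ρ n) x
  have hus : ∀ n x, |u n x - s x| ≤ L * r n := fun n x => by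
    have := (ρ n).dist_normed_convolution_le (μ := volume) (g := s) (x₀ := x) (ε := L * r n)
      hs.continuous.aestronglyMeasurable fun y hy => (hs.dist_le_mul y x).trans
        (mul_le_mul_of_nonneg_left (Metric.mem_ball.1 hy).le L.2)
    exact this
  -- Lebesgue differentiation; it requires a bounded ratio of outer to inner bump radius, here 2.
  have hdulim : ∀ᵐ x, Tendsto (fun n => du n x) atTop (𝓝 (fderiv ℝ s x)) := by
    refine ContDiffBump.ae_convolution_tendsto_right_of_locallyIntegrable (K := 2) hr0
      (Eventually.of_forall fun n => ?_) ?_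
    · exact (mul_div_cancel₀ (r n) two_ne_zero).ge
    · refine (locallyIntegrable_const (L : ℝ)).mono
        (measurable_fderiv ℝ s).aestronglyMeasurable (Eventually.of_forall fun x => ?_)
      rw [Real.norm_of_nonneg L.coe_nonneg]
      exact norm_fderiv_le_of_lipschitz ℝ hs
  let φ : ℕ → Eu d → ℝ := fun n x => ε n * T (u n x / ε n)
  have hφs : ∀ n, ContDiff ℝ ∞ (φ n) := fun n =>
    contDiff_const.mul (hT.comp ((hu n).div_const _))
  have hφd : ∀ n x, HasFDerivAt (φ n) (deriv T (u n x / ε n) • du n x) x := fun n x => by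
    have h1 : HasFDerivAt (fun x => u n x / ε n) ((ε n)⁻¹ • du n x) x := by
      simpa [div_eq_inv_mul] using (hdu n x).const_mul (ε n)⁻¹
    have h2 := ((hT.differentiable (by simp) (u n x / ε n)).hasDerivAt.comp_hasFDerivAt x h1)
    have h3 := h2.const_mul (ε n)
    refine h3.congr_fderiv ?_
    rw [smul_comm (ε n), smul_smul (ε n), mul_inv_cancel₀ (hε n).ne', one_smul]
  have hφg : ∀ n x, gradient (φ n) x =
      (InnerProductSpace.toDual ℝ (Eu d)).symm (deriv T (u n x / ε n) • du n x) := fun n x =>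
    (hφd n x).hasGradientAt.gradient
  have hφb : ∀ n x, ‖gradient (φ n) x‖ ≤ C * L := fun n x => by
    rw [hφg, LinearIsometryEquiv.norm_map, norm_smul]
    exact mul_le_mul (hTd _) (hdub n x) (norm_nonneg _) hC
  have hφS : ∀ n, tsupport (φ n) ⊆ {x | (L + 1) * r n ≤ |s x|} := fun n => by
    refine closure_minimal (fun x hx => ?_)
      (isClosed_le continuous_const hs.continuous.abs)
    have h1 : 1 < |u n x / ε n| := by
      by_contra h
      exact hx (by simp only [φ, hT0 _ (not_lt.1 h), mul_zero])
    rw [abs_div, abs_of_pos (hε n), one_lt_div (hε n)] at h1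
    have h2 := hus n x
    have h3 := abs_sub_abs_le_abs_sub (u n x) (s x)
    have h4 : ε n = (2 * L + 1) * r n := rfl
    show (L + 1) * r n ≤ |s x|
    linarith
  have hSΩ : ∀ n, {x | (L + 1) * r n ≤ |s x|} ⊆ Ω := fun n x hx => by
    refine hsupp fun h => ?_
    have hx : (L + 1) * r n ≤ |s x| := hx
    rw [h, abs_zero] at hx
    have : 0 < (L + 1) * r n := mul_pos (by positivity) (hr n)
    linarith
  refine ⟨φ, fun n => ⟨hφs n, ?_, (hφS n).trans (hSΩ n)⟩, ?_, ?_⟩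
  · exact hb.isCompact_closure.of_isClosed_subset (isClosed_tsupport _)
      (((hφS n).trans (hSΩ n)).trans subset_closure)
  · have hle : ∀ n x, ‖φ n x - s x‖ ≤ ε n * C + L * r n := fun n x => by
      have h1 : φ n x - s x = ε n * (T (u n x / ε n) - u n x / ε n) + (u n x - s x) := by
        have := (hε n).ne'
        simp only [φ]
        field_simp
        ring
      rw [h1]
      refine (norm_add_le _ _).trans (add_le_add ?_ (hus n x))
      rw [norm_mul, Real.norm_of_nonneg (hε n).le]
      exact mul_le_mul_of_nonneg_left (hTC _) (hε n).le
    have hlim : Tendsto (fun n => ε n * C + L * r n) atTop (𝓝 0) := by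
      simpa using (hε0.mul_const C).add (hr0.const_mul (L : ℝ))
    have hlim2 := ENNReal.Tendsto.const_mul (a := (volume.restrict Ω) univ ^ (2 : ℝ≥0∞).toReal⁻¹)
      (ENNReal.tendsto_ofReal hlim) (Or.inr (by simpa using hb.measure_lt_top.ne))
    rw [ENNReal.ofReal_zero, mul_zero] at hlim2
    exact tendsto_of_tendsto_of_tendsto_of_le_of_le tendsto_const_nhds hlim2
      (fun _ => zero_le) fun n => eLpNorm_le_of_ae_bound (Eventually.of_forall (hle n))
  · refine tendsto_eLpNorm_two_of_bounded
      (fun n => (continuous_gradient (hφs n)).aestronglyMeasurable) hmem hφb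
      (ae_restrict_of_ae ?_)
    filter_upwards [hdulim, hz] with x hx hxz
    simp only [hφg]
    refine ((InnerProductSpace.toDual ℝ (Eu d)).symm.continuous.tendsto _).comp ?_
    -- Where `s x = 0` the mollified derivatives tend to zero and `T'` is bounded; elsewhere `|u n
    -- x| > 2 ε n` eventually, so `T' = 1`.
    by_cases hsx : s x = 0
    · have hx0 : fderiv ℝ s x = 0 := by
        rw [← norm_eq_zero, ← norm_gradient, hxz hsx, norm_zero]
      rw [hx0] at hx ⊢
      refine squeeze_zero_norm (fun n => ?_) (by simpa using hx.norm.const_mul C)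
      rw [norm_smul]
      exact mul_le_mul_of_nonneg_right (hTd _) (norm_nonneg _)
    · refine hx.congr' ?_
      have hu0 : Tendsto (fun n => |u n x| - 2 * ε n) atTop (𝓝 |s x|) := by
        have : Tendsto (fun n => u n x) atTop (𝓝 (s x)) := by
          rw [tendsto_iff_norm_sub_tendsto_zero]
          exact squeeze_zero (fun _ => norm_nonneg _) (fun n => hus n x)
            (by simpa using hr0.const_mul (L : ℝ))
        simpa using this.abs.sub (hε0.const_mul 2)
      filter_upwards [hu0.eventually (lt_mem_nhds (abs_pos.2 hsx))] with n hn
      rw [hT1, one_smul]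
      rw [abs_div, abs_of_pos (hε n), lt_div_iff₀ (hε n)]
      linarith

/-! ### Piecewise affine interpolation -/

/-- The image of the segment from `x` to `y` is connected, so it contains the interval between `s x`
and `s y`. The part coming from `C i` has length at most `k i` times the distance, and the lengths
add up. No convexity of the pieces is needed, so the complement of `Ω` is allowed as a piece. -/
theorem exists_lipschitzWith_of_closed_cover {E ι : Type*} [NormedAddCommGroup E]
    [NormedSpace ℝ E] [Fintype ι] {s : E → ℝ} {C : ι → Set E} {k : ι → ℝ≥0}
    (hc : ∀ i, IsClosed (C i)) (hU : ⋃ i, C i = univ) (hk : ∀ i, LipschitzOnWith (k i) s (C i)) :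
    ∃ L, LipschitzWith L s := by
  have hs : Continuous s :=
    (locallyFinite_of_finite C).continuous hU hc fun i => (hk i).continuousOn
  refine ⟨∑ i, k i, fun x y => ?_⟩
  have hpre : (s '' segment ℝ x y).OrdConnected :=
    ((convex_segment x y).isPreconnected.image s hs.continuousOn).ordConnected
  have hsub : uIcc (s x) (s y) ⊆ ⋃ i, s '' (segment ℝ x y ∩ C i) := by
    rw [← image_iUnion, ← inter_iUnion, hU, inter_univ]
    exact hpre.uIcc_subset (mem_image_of_mem s (left_mem_segment ℝ x y))
      (mem_image_of_mem s (right_mem_segment ℝ x y))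
  have hseg : Metric.ediam (segment ℝ x y) = edist x y := by
    rw [← convexHull_pair, convexHull_ediam, Metric.ediam_pair]
  have hd : ∀ i, volume (s '' (segment ℝ x y ∩ C i)) ≤ k i * edist x y := fun i => by
    refine (Real.volume_le_diam _).trans (Metric.ediam_le ?_)
    rintro _ ⟨p, hp, rfl⟩ _ ⟨q, hq, rfl⟩
    refine (hk i hp.2 hq.2).trans (mul_le_mul_right ?_ _)
    rw [← hseg]
    exact Metric.edist_le_ediam_of_mem hp.1 hq.1
  calc edist (s x) (s y) = volume (uIcc (s x) (s y)) := by
        rw [Real.volume_interval, edist_comm, edist_dist, Real.dist_eq]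
    _ ≤ ∑ i, volume (s '' (segment ℝ x y ∩ C i)) :=
        (measure_mono hsub).trans (measure_iUnion_fintype_le _ _)
    _ ≤ ∑ i, k i * edist x y := Finset.sum_le_sum fun i _ => hd i
    _ = (∑ i, k i : ℝ≥0) * edist x y := by rw [← Finset.sum_mul, ENNReal.ofNNReal_finsetSum]

theorem volume_hyperplane {d : ℕ} {g : Eu d} (hg : g ≠ 0) (c : ℝ) :
    volume {x : Eu d | ⟪g, x⟫ + c = 0} = 0 := by
  let A : AffineSubspace ℝ (Eu d) :=
    { carrier := {x | ⟪g, x⟫ + c = 0}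
      smul_vsub_vadd_mem' := fun t x y z hx hy hz => by
        simp only [mem_ofPred_eq, vsub_eq_sub, vadd_eq_add, inner_add_right, inner_smul_right,
          inner_sub_right] at hx hy hz ⊢
        linear_combination t * hx - t * hy + hz }
  refine Measure.addHaar_affineSubspace volume A fun hA => hg ?_
  have hmem : ∀ x : Eu d, ⟪g, x⟫ + c = 0 := fun x => by
    have : x ∈ A := hA ▸ AffineSubspace.mem_top ℝ (Eu d) x
    exact this
  have h0 := hmem 0
  have h1 := hmem g
  rw [inner_zero_right, zero_add] at h0
  rw [h0, add_zero] at h1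
  exact inner_self_eq_zero.1 h1

theorem hasGradientAt_affine {d : ℕ} (g : Eu d) (c : ℝ) (x : Eu d) :
    HasGradientAt (fun x => ⟪g, x⟫ + c) g x := by
  rw [hasGradientAt_iff_hasFDerivAt]
  exact ((InnerProductSpace.toDual ℝ (Eu d)) g).hasFDerivAt.add_const c

/-- A vertex which contributes to a boundary point of the domain lies on the boundary. -/
theorem SimplicialMesh.mem_frontier_of_isBarycentric {d : ℕ} {Ω : Set (Eu d)}
    (M : SimplicialMesh d Ω) (hΩ : IsOpen Ω) (hL : HasLipschitzBoundary Ω) {κ : Finset (Eu d)}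
    (hκ : κ ∈ M.simplices) {x : Eu d} (hx : x ∈ frontier Ω) {w : Eu d → ℝ}
    (hw : IsBarycentric κ x w) {a : Eu d} (ha : w a ≠ 0) : a ∈ frontier Ω := by
  classical
  have haκ : a ∈ κ := by_contra fun h => ha (hw.zero a h)
  have hwa : 0 < w a := lt_of_le_of_ne (hw.nonneg a haκ) ha.symm
  rw [hΩ.frontier_eq] at hx ⊢
  refine ⟨M.convexHull_subset_closure hκ (subset_convexHull ℝ _ haκ), fun haΩ => hx.2 ?_⟩
  -- a point `y` of the segment from `x` to `a`, close to `a`, with the same carrier as `x`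
  obtain ⟨t, ht0, ht1, hyΩ⟩ : ∃ t : ℝ, 0 < t ∧ t < 1 ∧ (1 - t) • x + t • a ∈ Ω := by
    have hc : Continuous fun t : ℝ => (1 - t) • x + t • a := by fun_prop
    have h1 := hc.tendsto 1
    simp only [sub_self, zero_smul, one_smul, zero_add] at h1
    have h2 := (h1.mono_left (nhdsWithin_le_nhds (s := Iio 1))).eventually (hΩ.mem_nhds haΩ)
    obtain ⟨t, h3, h4⟩ := (h2.and (Ioo_mem_nhdsLT one_pos)).exists
    exact ⟨t, h4.1, h4.2, h3⟩
  set y := (1 - t) • x + t • a with hy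
  let v : Eu d → ℝ := fun b => (1 - t) * w b + t * if b = a then 1 else 0
  have hv : IsBarycentric κ y v := by
    refine ⟨fun b hb => ?_, ?_, ?_, fun b hb => ?_⟩
    · have := hw.nonneg b hb
      have : 0 ≤ 1 - t := by linarith
      simp only [v]
      positivity
    · simp only [v]
      rw [Finset.sum_add_distrib, ← Finset.mul_sum, ← Finset.mul_sum, hw.sum_eq,
        Finset.sum_ite_eq' κ a, if_pos haκ]
      ring
    · simp only [v, add_smul, mul_smul]
      rw [Finset.sum_add_distrib, ← Finset.smul_sum, ← Finset.smul_sum, hw.sum_smul]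
      simp [ite_smul, haκ, hy]
    · simp only [v, hw.zero b hb, if_neg (fun h : b = a => hb (h ▸ haκ)), mul_zero, add_zero]
  have hvw : ∀ b, v b = 0 → w b = 0 := fun b hb => by
    have h1 := hw.nonneg_all b
    have h2 : 0 < 1 - t := by linarith
    simp only [v] at hb
    split_ifs at hb
    · nlinarith
    · rw [mul_zero, add_zero] at hb
      exact (mul_eq_zero.1 hb).resolve_left h2.ne'
  -- This bound is what later keeps the coordinates `w + w a * (q - v)` nonnegative.
  have hwv : ∀ b, w a * v b ≤ w b := fun b => by
    have h1 := hw.nonneg_all b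
    have h2 := hw.le_one a
    by_cases hb : b = a
    · subst hb
      have := hv.le_one b
      nlinarith
    · simp only [v, if_neg hb, mul_zero, add_zero]
      have h3 : w a * (1 - t) ≤ 1 := by nlinarith
      nlinarith
  -- Removing the simplices that miss `y` leaves a neighbourhood `N` of `y` met only by simplices
  -- containing `y`, and these also contain `x`.
  let G : Finset (Finset (Eu d)) :=
    M.simplices.filter fun κ' => y ∉ convexHull ℝ (κ' : Set (Eu d))
  let N : Set (Eu d) := Ω ∩ ⋂ κ' ∈ G, (convexHull ℝ (κ' : Set (Eu d)))ᶜ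
  have hN : IsOpen N := hΩ.inter (isOpen_biInter_finset fun κ' _ =>
    (isClosed_convexHull_finset κ').isOpen_compl)
  have hyN : y ∈ N := ⟨hyΩ, mem_iInter₂.2 fun κ' hκ' => (Finset.mem_filter.1 hκ').2⟩
  -- This dilation sends `x` to `y`. If the image of `z` lies in a simplex `κ'` around `y`, then `z`
  -- itself lies in `κ'`; so a whole neighbourhood of `x` lies in `closure Ω`, and `x ∈ Ω`, a
  -- contradiction.
  have hcont : Continuous fun z : Eu d => y + (w a)⁻¹ • (z - x) := by fun_prop
  rw [← hL.interior_closure hΩ]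
  refine mem_interior.2 ⟨_, fun z hz => ?_, hN.preimage hcont, by simpa using hyN⟩
  obtain ⟨hzΩ, hzN⟩ : y + (w a)⁻¹ • (z - x) ∈ N := hz
  obtain ⟨κ', hκ', hzκ⟩ := mem_simplexUnion.1 (M.union_eq ▸ subset_closure hzΩ)
  have hyκ : y ∈ convexHull ℝ (κ' : Set (Eu d)) := by
    by_contra h
    exact mem_iInter₂.1 hzN κ' (Finset.mem_filter.2 ⟨hκ', h⟩) hzκ
  obtain ⟨v', hv'⟩ := exists_isBarycentric hyκ
  have := M.isBarycentric_unique hκ hκ' hv hv'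
  rw [← this] at hv'
  obtain ⟨q, hq⟩ := exists_isBarycentric hzκ
  have hw0 : ∀ b, b ∉ κ' → w b = 0 := fun b hb => hvw b (hv'.zero b hb)
  have hsum : ∀ b, b ∈ κ ∪ κ' → b ∉ κ' → w b = 0 := fun b _ hb => hw0 b hb
  have hw' : IsBarycentric κ' x w := by
    refine ⟨fun b _ => hw.nonneg_all b, ?_, ?_, hw0⟩
    · rw [← (hw.mono (Finset.subset_union_left (s₂ := κ'))).sum_eq]
      exact Finset.sum_subset Finset.subset_union_right hsum
    · rw [← (hw.mono (Finset.subset_union_left (s₂ := κ'))).sum_smul]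
      exact Finset.sum_subset Finset.subset_union_right fun b hb hb' => by
        rw [hsum b hb hb', zero_smul]
  refine M.convexHull_subset_closure hκ' (Finset.mem_convexHull'.2
    ⟨fun b => w b + w a * (q b - v b), fun b hb => ?_, ?_, ?_⟩)
  · have h1 := hwv b
    have h2 := mul_nonneg hwa.le (hq.nonneg b hb)
    show 0 ≤ w b + w a * (q b - v b)
    linarith
  · rw [Finset.sum_add_distrib, ← Finset.mul_sum, Finset.sum_sub_distrib, hw'.sum_eq, hq.sum_eq,
      hv'.sum_eq]
    ring
  · simp only [add_smul, mul_smul, sub_smul]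
    rw [Finset.sum_add_distrib, ← Finset.smul_sum, Finset.sum_sub_distrib, hw'.sum_smul,
      hq.sum_smul, hv'.sum_smul, add_sub_cancel_left, smul_smul, mul_inv_cancel₀ hwa.ne', one_smul,
      add_sub_cancel]

/-! ### Hat functions and the interpolant of the point values -/

namespace PolytopalMesh

variable {d : ℕ} {Ω : Set (Eu d)} {ι Φ : Type*} [Fintype ι] [Fintype Φ]
  (M : PolytopalMesh d Ω ι Φ)

theorem hat_eq {κ : Finset (Eu d)} (hκ : κ ∈ M.simplices) {x : Eu d} {w : Eu d → ℝ}
    (h : IsBarycentric κ x w) (a : Eu d) : M.hat a x = w a := by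
  have hex : ∃ w : Eu d → ℝ, ∃ κ ∈ M.simplices, IsBarycentric κ x w := ⟨w, κ, hκ, h⟩
  rw [hat, dif_pos hex]
  obtain ⟨κ', hκ', h'⟩ := hex.choose_spec
  rw [M.isBarycentric_unique hκ' hκ h' h]

theorem hat_of_notMem_closure {x : Eu d} (hx : x ∉ closure Ω) (a : Eu d) : M.hat a x = 0 := by
  refine dif_neg ?_
  rintro ⟨w, κ, hκ, h⟩
  exact hx (M.convexHull_subset_closure hκ h.mem_convexHull)

theorem hat_of_notMem {κ : Finset (Eu d)} (hκ : κ ∈ M.simplices) {x : Eu d}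
    (hx : x ∈ convexHull ℝ (κ : Set (Eu d))) {a : Eu d} (ha : a ∉ κ) : M.hat a x = 0 := by
  obtain ⟨w, hw⟩ := exists_isBarycentric hx
  rw [M.hat_eq hκ hw, hw.zero a ha]

theorem hat_affine {κ : Finset (Eu d)} (hκ : κ ∈ M.simplices) (a : Eu d) :
    ∃ (g : Eu d) (c : ℝ), ∀ x ∈ convexHull ℝ (κ : Set (Eu d)), M.hat a x = ⟪g, x⟫ + c := by
  by_cases ha : a ∈ κ
  · let A := (M.affineBasis hκ).coord ⟨a, ha⟩
    refine ⟨(InnerProductSpace.toDual ℝ (Eu d)).symm A.linear.toContinuousLinearMap, A 0,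
      fun x hx => ?_⟩
    obtain ⟨w, hw⟩ := exists_isBarycentric hx
    rw [M.hat_eq hκ hw, ← M.coord_eq hκ hw ⟨a, ha⟩, InnerProductSpace.toDual_symm_apply]
    exact congrFun A.decomp x
  · exact ⟨0, 0, fun x hx => by rw [M.hat_of_notMem hκ hx ha, inner_zero_left, zero_add]⟩

open Classical in
/-- The continuous piecewise affine function with the vertex values `z`. -/
noncomputable def interp (z : Eu d → ℝ) (x : Eu d) : ℝ :=
  ∑ a ∈ M.simplices.biUnion id, z a * M.hat a x

theorem interp_of_notMem_closure (z : Eu d → ℝ) {x : Eu d} (hx : x ∉ closure Ω) :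
    M.interp z x = 0 :=
  Finset.sum_eq_zero fun a _ => by rw [M.hat_of_notMem_closure hx, mul_zero]

/-- Hats of vertices outside `κ` vanish on `κ`, so `V` is free: `V = κ` shows affinity, `V =
M.elemVertices K` leads to the element matrices. -/
theorem interp_eq_sum (z : Eu d → ℝ) {κ : Finset (Eu d)} (hκ : κ ∈ M.simplices) {x : Eu d}
    (hx : x ∈ convexHull ℝ (κ : Set (Eu d))) {V : Finset (Eu d)} (hV : κ ⊆ V) :
    M.interp z x = ∑ a ∈ V, z a * M.hat a x := by
  classical
  have h : ∀ a, a ∉ κ → z a * M.hat a x = 0 := fun a ha => by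
    rw [M.hat_of_notMem hκ hx ha, mul_zero]
  rw [interp, ← Finset.sum_subset hV fun a _ ha => h a ha]
  exact (Finset.sum_subset (fun a ha => Finset.mem_biUnion.2 ⟨κ, hκ, ha⟩)
    fun a _ ha => h a ha).symm

theorem interp_affine (z : Eu d → ℝ) {κ : Finset (Eu d)} (hκ : κ ∈ M.simplices) :
    ∃ (g : Eu d) (c : ℝ), ∀ x ∈ convexHull ℝ (κ : Set (Eu d)), M.interp z x = ⟪g, x⟫ + c := by
  choose g c h using fun a => M.hat_affine hκ a
  refine ⟨∑ a ∈ κ, z a • g a, ∑ a ∈ κ, z a * c a, fun x hx => ?_⟩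
  rw [M.interp_eq_sum z hκ hx subset_rfl, sum_inner, ← Finset.sum_add_distrib]
  refine Finset.sum_congr rfl fun a _ => ?_
  rw [h a x hx, real_inner_smul_left]
  ring

theorem interp_of_notMem (hΩ : IsOpen Ω) (hL : HasLipschitzBoundary Ω) {z : Eu d → ℝ}
    (hz : ∀ a ∈ frontier Ω, z a = 0) {x : Eu d} (hx : x ∉ Ω) : M.interp z x = 0 := by
  by_cases hxc : x ∈ closure Ω
  · have hxf : x ∈ frontier Ω := by
      rw [hΩ.frontier_eq]
      exact ⟨hxc, hx⟩
    obtain ⟨κ, hκ, hxκ⟩ := mem_simplexUnion.1 (M.union_eq ▸ hxc)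
    obtain ⟨w, hw⟩ := exists_isBarycentric hxκ
    rw [M.interp_eq_sum z hκ hxκ subset_rfl]
    refine Finset.sum_eq_zero fun a _ => ?_
    rw [M.hat_eq hκ hw]
    by_cases ha : w a = 0
    · rw [ha, mul_zero]
    · rw [hz a (M.mem_frontier_of_isBarycentric hΩ hL hκ hxf hw ha), zero_mul]
  · exact M.interp_of_notMem_closure z hxc

theorem exists_lipschitzWith_interp (hΩ : IsOpen Ω) (hL : HasLipschitzBoundary Ω)
    {z : Eu d → ℝ} (hz : ∀ a ∈ frontier Ω, z a = 0) : ∃ L, LipschitzWith L (M.interp z) := by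
  choose g c h using fun κ : M.simplices => M.interp_affine z κ.2
  refine exists_lipschitzWith_of_closed_cover (ι := Option M.simplices)
    (C := fun i => i.elim Ωᶜ fun κ => convexHull ℝ ((κ : Finset (Eu d)) : Set (Eu d)))
    (k := fun i => i.elim 0 fun κ => ‖g κ‖₊) ?_ ?_ ?_
  · rintro (_ | κ)
    · exact hΩ.isClosed_compl
    · exact isClosed_convexHull_finset _
  · refine eq_univ_of_forall fun x => ?_
    by_cases hx : x ∈ Ω
    · obtain ⟨κ, hκ, hxκ⟩ := mem_simplexUnion.1 (M.union_eq ▸ subset_closure hx)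
      exact mem_iUnion.2 ⟨some ⟨κ, hκ⟩, hxκ⟩
    · exact mem_iUnion.2 ⟨none, hx⟩
  · rintro (_ | κ)
    · refine LipschitzOnWith.of_dist_le_mul fun x hx y hy => ?_
      rw [M.interp_of_notMem hΩ hL hz hx, M.interp_of_notMem hΩ hL hz hy, dist_self]
      positivity
    · refine LipschitzOnWith.of_dist_le_mul fun x hx y hy => ?_
      rw [h κ x hx, h κ y hy, dist_add_right, Real.dist_eq, ← inner_sub_right, dist_eq_norm]
      exact abs_real_inner_le_norm _ _

theorem ae_mem_interior : ∀ᵐ x : Eu d, ∀ κ ∈ M.simplices,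
    x ∈ convexHull ℝ (κ : Set (Eu d)) → x ∈ interior (convexHull ℝ (κ : Set (Eu d))) := by
  refine (ae_ball_iff M.simplices.countable_toSet).2 fun κ _ => ?_
  filter_upwards [measure_eq_zero_iff_ae_notMem.1 (SimplicialMesh.volume_frontier_convexHull κ)]
    with x hx hxκ
  by_contra h
  exact hx ⟨subset_closure hxκ, h⟩

/-- On a simplex the interpolant is affine; if its gradient is nonzero, its zeros lie in a
hyperplane, which is null. -/
theorem ae_gradient_interp (z : Eu d → ℝ) :
    ∀ᵐ x, M.interp z x = 0 → gradient (M.interp z) x = 0 := by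
  choose g c h using fun κ : M.simplices => M.interp_affine z κ.2
  have hnull : ∀ᵐ x : Eu d, ∀ κ : M.simplices, g κ ≠ 0 → ⟪g κ, x⟫ + c κ ≠ 0 := by
    refine ae_all_iff.2 fun κ => ?_
    by_cases hg : g κ = 0
    · exact Eventually.of_forall fun x h => (h hg).elim
    · filter_upwards [measure_eq_zero_iff_ae_notMem.1 (volume_hyperplane hg (c κ))] with x hx _
      exact hx
  filter_upwards [M.ae_mem_interior, hnull] with x hx hxn hx0
  by_cases hxc : x ∈ closure Ω
  · obtain ⟨κ, hκ, hxκ⟩ := mem_simplexUnion.1 (M.union_eq ▸ hxc)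
    have hev : M.interp z =ᶠ[𝓝 x] fun y => ⟪g ⟨κ, hκ⟩, y⟫ + c ⟨κ, hκ⟩ := by
      filter_upwards [isOpen_interior.mem_nhds (hx κ hκ hxκ)] with y hy
      exact h ⟨κ, hκ⟩ y (interior_subset hy)
    rw [hev.gradient_eq, (hasGradientAt_affine _ _ x).gradient]
    by_contra hg
    exact hxn ⟨κ, hκ⟩ hg (by rw [← h ⟨κ, hκ⟩ x hxκ, hx0])
  · have hev : M.interp z =ᶠ[𝓝 x] fun _ => 0 := by
      filter_upwards [isClosed_closure.isOpen_compl.mem_nhds hxc] with y hy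
      exact M.interp_of_notMem_closure z hy
    rw [hev.gradient_eq, gradient_fun_const]

theorem isH10_interp (hΩ : IsOpen Ω) (hb : Bornology.IsBounded Ω) (hL : HasLipschitzBoundary Ω)
    {z : Eu d → ℝ} (hz : ∀ a ∈ frontier Ω, z a = 0) :
    IsH10 Ω (M.interp z) (gradient (M.interp z)) := by
  obtain ⟨L, hLip⟩ := M.exists_lipschitzWith_interp hΩ hL hz
  exact hLip.isH10 hb (fun x hx => M.interp_of_notMem hΩ hL hz hx) (M.ae_gradient_interp z)

end PolytopalMesh

/-! ### Duality between the gradient and the divergence -/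

theorem tendsto_integral_inner {α E : Type*} [MeasurableSpace α] [NormedAddCommGroup E]
    [InnerProductSpace ℝ E] {μ : Measure α} {u G : α → E} {F : ℕ → α → E} (hu : MemLp u 2 μ)
    (hF : ∀ n, MemLp (F n) 2 μ) (hG : MemLp G 2 μ)
    (h : Tendsto (fun n => eLpNorm (fun x => F n x - G x) 2 μ) atTop (𝓝 0)) :
    Tendsto (fun n => ∫ x, ⟪u x, F n x⟫ ∂μ) atTop (𝓝 (∫ x, ⟪u x, G x⟫ ∂μ)) := by
  have key : ∀ (v : α → E) (hv : MemLp v 2 μ),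
      ⟪hu.toLp u, hv.toLp v⟫ = ∫ x, ⟪u x, v x⟫ ∂μ := fun v hv => by
    rw [L2.inner_def]
    refine integral_congr_ae ?_
    filter_upwards [hu.coeFn_toLp, hv.coeFn_toLp] with x h1 h2
    rw [h1, h2]
  have h1 := (Lp.tendsto_Lp_iff_tendsto_eLpNorm'' F hF G hG).2 h
  have h2 := Filter.Tendsto.inner (𝕜 := ℝ)
    (tendsto_const_nhds (x := hu.toLp u) (f := (atTop : Filter ℕ))) h1
  simpa only [key] using h2

/-- Green's formula for `H(div)` fields and functions in `H¹₀`. -/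
theorem HasWeakDivergence.integral_inner_eq {d : ℕ} {Ω : Set (Eu d)} {u : Eu d → Eu d}
    {w : Eu d → ℝ} (hu : HasWeakDivergence Ω u w) {v : Eu d → ℝ} {g : Eu d → Eu d}
    (hv : IsH10 Ω v g) : ∫ x in Ω, ⟪u x, g x⟫ = - ∫ x in Ω, w x * v x := by
  obtain ⟨φ, hφ, h1, h2⟩ := hv.approx
  have t1 := tendsto_integral_inner hu.memLp (fun n => (hφ n).memLp_gradient _)
    hv.weakGradient.memLp_grad h2
  have t2 := tendsto_integral_inner hu.memLp_div (fun n => (hφ n).memLp _)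
    hv.weakGradient.memLp h1
  simp only [(hu.integral_eq _ (hφ _))] at t1
  have hmul : ∀ a b : ℝ, ⟪a, b⟫ = a * b := fun a b => by simp [mul_comm]
  simp only [hmul] at t2
  exact tendsto_nhds_unique t1 t2.neg

/-! ### Positive definite tensors -/

section Tensor

variable {d : ℕ} {k : Matrix (Fin d) (Fin d) ℝ}

theorem Matrix.PosDef.inner_toEuclideanLin_comm (hk : k.PosDef) (x y : Eu d) :
    ⟪k.toEuclideanLin x, y⟫ = ⟪x, k.toEuclideanLin y⟫ :=
  Matrix.isSymmetric_toEuclideanLin_iff.2 hk.isHermitian x y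

theorem Matrix.PosDef.inner_toEuclideanLin_nonneg (hk : k.PosDef) (x : Eu d) :
    0 ≤ ⟪k.toEuclideanLin x, x⟫ :=
  (Matrix.isPositive_toEuclideanLin_iff.2 hk.posSemidef).2 x

theorem Matrix.PosDef.toEuclideanLin_inv_apply (hk : k.PosDef) (x : Eu d) :
    (k⁻¹).toEuclideanLin (k.toEuclideanLin x) = x := by
  have h : k⁻¹ * k = 1 := Matrix.nonsing_inv_mul _ ((Matrix.isUnit_iff_isUnit_det k).1 hk.isUnit)
  have h2 := Matrix.toLpLin_mul 2 2 2 k⁻¹ k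
  rw [h, Matrix.toLpLin_one] at h2
  exact (LinearMap.congr_fun h2 x).symm

/-- The tensor and its inverse cancel in the cross terms, leaving `u · g`, to which Green's formula
applies. -/
theorem Matrix.PosDef.inner_flux_sub (hk : k.PosDef) (g u : Eu d) :
    ⟪- k.toEuclideanLin g - u, (k⁻¹).toEuclideanLin (- k.toEuclideanLin g - u)⟫ =
      ⟪u, (k⁻¹).toEuclideanLin u⟫ + 2 * ⟪u, g⟫ + ⟪k.toEuclideanLin g, g⟫ := by
  have h : ⟪k.toEuclideanLin g, (k⁻¹).toEuclideanLin u⟫ = ⟪u, g⟫ := by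
    rw [← hk.inv.inner_toEuclideanLin_comm, hk.toEuclideanLin_inv_apply, real_inner_comm]
  rw [map_sub, map_neg, hk.toEuclideanLin_inv_apply]
  simp only [inner_sub_left, inner_sub_right, inner_neg_left, inner_neg_right, h]
  ring

/-- Nonnegativity of the quadratic form at `g - g'`. -/
theorem Matrix.PosDef.two_mul_inner_le (hk : k.PosDef) (g g' : Eu d) :
    2 * ⟪k.toEuclideanLin g, g'⟫ ≤ ⟪k.toEuclideanLin g, g⟫ + ⟪k.toEuclideanLin g', g'⟫ := by
  have h := hk.inner_toEuclideanLin_nonneg (g - g')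
  have h2 : ⟪k.toEuclideanLin g', g⟫ = ⟪k.toEuclideanLin g, g'⟫ := by
    rw [hk.inner_toEuclideanLin_comm, real_inner_comm]
  simp only [map_sub, inner_sub_left, inner_sub_right, h2] at h
  linarith

end Tensor

/-! ### Element matrices -/

namespace PolytopalMesh

variable {d : ℕ} {Ω : Set (Eu d)} {ι Φ : Type*} [Fintype ι] [Fintype Φ]
  (M : PolytopalMesh d Ω ι Φ)

theorem memLp_toEuclideanLin (hΩ : IsOpen Ω) (hL : HasLipschitzBoundary Ω)
    {A : Eu d → Matrix (Fin d) (Fin d) ℝ}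
    (hA : ∀ K, ∃ k : Matrix (Fin d) (Fin d) ℝ, ∀ x ∈ interior (M.elem K), A x = k)
    {v : Eu d → Eu d} (hv : MemLp v 2 (volume.restrict Ω)) :
    MemLp (fun x => (A x).toEuclideanLin (v x)) 2 (volume.restrict Ω) := by
  refine M.memLp_domain hΩ hL fun K => ?_
  obtain ⟨k, hk⟩ := hA K
  rw [← M.restrict_interior_elem K]
  have hsub : interior (M.elem K) ⊆ Ω :=
    (interior_mono (M.elem_subset_closure K)).trans (hL.interior_closure hΩ).subset
  refine ((k.toEuclideanLin.toContinuousLinearMap).comp_memLp'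
    (hv.mono_measure (Measure.restrict_mono hsub le_rfl))).ae_eq ?_
  filter_upwards [ae_restrict_mem isOpen_interior.measurableSet] with x hx
  rw [hk x hx]
  rfl

theorem ae_elem (K : ι) : ∀ᵐ x ∂volume.restrict (M.elem K), ∃ κ ∈ M.submesh K,
    x ∈ interior (convexHull ℝ (κ : Set (Eu d))) := by
  filter_upwards [ae_restrict_of_ae M.ae_mem_interior,
    ae_restrict_mem (M.isClosed_elem K).measurableSet] with x hx hxK
  obtain ⟨κ, hκ, hxκ⟩ := M.mem_elem.1 hxK
  exact ⟨κ, hκ, hx κ (M.mem_simplices hκ) hxκ⟩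

theorem subset_elemVertices {K : ι} {κ : Finset (Eu d)} (h : κ ∈ M.submesh K) :
    κ ⊆ M.elemVertices K := by
  classical
  exact fun a ha => Finset.mem_biUnion.2 ⟨κ, h, ha⟩

theorem exists_hasGradientAt_hat {κ : Finset (Eu d)} (hκ : κ ∈ M.simplices) (a : Eu d) :
    ∃ g : Eu d, ∀ x ∈ interior (convexHull ℝ (κ : Set (Eu d))), HasGradientAt (M.hat a) g x := by
  obtain ⟨g, c, h⟩ := M.hat_affine hκ a
  refine ⟨g, fun x hx => (hasGradientAt_affine g c x).congr_of_eventuallyEq ?_⟩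
  filter_upwards [isOpen_interior.mem_nhds hx] with y hy
  exact h y (interior_subset hy)

theorem gradient_interp_eq (z : Eu d → ℝ) {K : ι} {κ : Finset (Eu d)} (hκ : κ ∈ M.submesh K)
    {x : Eu d} (hx : x ∈ interior (convexHull ℝ (κ : Set (Eu d)))) :
    gradient (M.interp z) x = ∑ a ∈ M.elemVertices K, z a • gradient (M.hat a) x := by
  have hev : M.interp z =ᶠ[𝓝 x] fun y => ∑ a ∈ M.elemVertices K, z a * M.hat a y := by
    filter_upwards [isOpen_interior.mem_nhds hx] with y hy
    exact M.interp_eq_sum z (M.mem_simplices hκ) (interior_subset hy) (M.subset_elemVertices hκ)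
  rw [hev.gradient_eq]
  have hsum := HasFDerivAt.fun_sum (x := x) (u := M.elemVertices K)
    (A := fun a y => z a * M.hat a y) (A' := fun a => z a • fderiv ℝ (M.hat a) x) fun a _ => by
      obtain ⟨g, hg⟩ := M.exists_hasGradientAt_hat (M.mem_simplices hκ) a
      exact (hg x hx).differentiableAt.hasFDerivAt.const_mul (z a)
  rw [hsum.hasGradientAt.gradient, map_sum]
  exact Finset.sum_congr rfl fun a _ => map_smul _ _ _

theorem integrableOn_elem_of_const {K : ι} {F : Eu d → ℝ} (h : ∀ κ ∈ M.submesh K, ∃ c,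
    ∀ x ∈ interior (convexHull ℝ (κ : Set (Eu d))), F x = c) : IntegrableOn F (M.elem K) := by
  rw [IntegrableOn, Measure.restrict_congr_set (M.elem_ae_eq_iUnion_interior K)]
  refine integrableOn_finset_iUnion.2 fun κ hκ => ?_
  obtain ⟨c, hc⟩ := h κ hκ
  refine IntegrableOn.congr_fun (f := fun _ => c) ?_ (fun x hx => (hc x hx).symm)
    isOpen_interior.measurableSet
  exact integrableOn_const
    (((measure_mono interior_subset).trans_lt (isCompact_convexHull_finset κ).measure_lt_top).ne)

theorem continuousOn_hat {κ : Finset (Eu d)} (hκ : κ ∈ M.simplices) (a : Eu d) :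
    ContinuousOn (M.hat a) (convexHull ℝ (κ : Set (Eu d))) := by
  obtain ⟨g, c, h⟩ := M.hat_affine hκ a
  exact ContinuousOn.congr (f := fun x => ⟪g, x⟫ + c) (by fun_prop) h

theorem integrableOn_hat_mul_hat (K : ι) (a a' : Eu d) :
    IntegrableOn (fun x => M.hat a' x * M.hat a x) (M.elem K) := by
  rw [elem, simplexUnion]
  refine integrableOn_finset_iUnion.2 fun κ hκ => ?_
  exact ((M.continuousOn_hat (M.mem_simplices hκ) a').mul
    (M.continuousOn_hat (M.mem_simplices hκ) a)).integrableOn_compact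
    (isCompact_convexHull_finset κ)

theorem sum_hat {K : ι} {x : Eu d} (hx : x ∈ M.elem K) :
    ∑ a ∈ M.elemVertices K, M.hat a x = 1 := by
  obtain ⟨κ, hκ, hxκ⟩ := M.mem_elem.1 hx
  obtain ⟨w, hw⟩ := exists_isBarycentric hxκ
  rw [← (hw.mono (M.subset_elemVertices hκ)).sum_eq]
  exact Finset.sum_congr rfl fun a _ => M.hat_eq (M.mem_simplices hκ) hw a

theorem stiffness_quadratic {Km : Eu d → Matrix (Fin d) (Fin d) ℝ} {K : ι}
    {k : Matrix (Fin d) (Fin d) ℝ} (hk : ∀ x ∈ interior (M.elem K), Km x = k) (z : Eu d → ℝ) :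
    (fun a : M.elemVertices K => z a) ⬝ᵥ (M.stiffness Km K *ᵥ fun a => z a) =
      ∫ x in M.elem K,
        ⟪(Km x).toEuclideanLin (gradient (M.interp z) x), gradient (M.interp z) x⟫ := by
  have hint : ∀ a a' : M.elemVertices K, IntegrableOn (fun x =>
      ⟪(Km x).toEuclideanLin (gradient (M.hat a') x), gradient (M.hat a) x⟫) (M.elem K) :=
    fun a a' => M.integrableOn_elem_of_const fun κ hκ => by
      obtain ⟨g, hg⟩ := M.exists_hasGradientAt_hat (M.mem_simplices hκ) a
      obtain ⟨g', hg'⟩ := M.exists_hasGradientAt_hat (M.mem_simplices hκ) a'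
      exact ⟨⟪k.toEuclideanLin g', g⟫, fun x hx => by
        rw [(hg x hx).gradient, (hg' x hx).gradient,
          hk x (interior_mono (M.convexHull_subset_elem hκ) hx)]⟩
  have hrhs : ∫ x in M.elem K,
        ⟪(Km x).toEuclideanLin (gradient (M.interp z) x), gradient (M.interp z) x⟫ =
      ∫ x in M.elem K, ∑ a : M.elemVertices K, ∑ a' : M.elemVertices K, z a * z a' *
        ⟪(Km x).toEuclideanLin (gradient (M.hat a') x), gradient (M.hat a) x⟫ := by
    refine integral_congr_ae ?_
    filter_upwards [M.ae_elem K] with x ⟨κ, hκ, hx⟩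
    rw [M.gradient_interp_eq z hκ hx, map_sum, inner_sum]
    rw [← Finset.sum_coe_sort (M.elemVertices K)]
    refine Finset.sum_congr rfl fun a _ => ?_
    rw [sum_inner, ← Finset.sum_coe_sort (M.elemVertices K)]
    refine Finset.sum_congr rfl fun a' _ => ?_
    rw [map_smul, real_inner_smul_left, real_inner_smul_right]
    ring
  rw [hrhs, integral_finsetSum _ fun a _ => integrable_finsetSum _ fun a' _ =>
    (hint a a').const_mul _]
  refine Finset.sum_congr rfl fun a _ => ?_
  rw [integral_finsetSum _ fun a' _ => (hint a a').const_mul _, Matrix.mulVec, dotProduct,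
    Finset.mul_sum]
  refine Finset.sum_congr rfl fun a' _ => ?_
  rw [integral_const_mul, stiffness]
  ring

/-- The hats form a partition of unity on the element, so pairing the mass matrix with the vector of
ones just integrates the interpolant. -/
theorem one_dotProduct_mass (K : ι) (z : Eu d → ℝ) :
    (fun _ : M.elemVertices K => (1 : ℝ)) ⬝ᵥ (M.mass K *ᵥ fun a => z a) =
      ∫ x in M.elem K, M.interp z x := by
  have hrhs : ∫ x in M.elem K, M.interp z x = ∫ x in M.elem K, ∑ a : M.elemVertices K,
      ∑ a' : M.elemVertices K, z a' * (M.hat a' x * M.hat a x) := by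
    refine setIntegral_congr_fun (M.isClosed_elem K).measurableSet fun x hx => ?_
    obtain ⟨κ, hκ, hxκ⟩ := M.mem_elem.1 hx
    have h1 := M.sum_hat hx
    have h2 := M.interp_eq_sum z (M.mem_simplices hκ) hxκ (M.subset_elemVertices hκ)
    rw [← Finset.sum_coe_sort] at h1 h2
    simp only [← mul_assoc, ← Finset.sum_mul, ← h2, ← Finset.mul_sum, h1, mul_one]
  have hint : ∀ a a' : M.elemVertices K,
      IntegrableOn (fun x => M.hat a' x * M.hat a x) (M.elem K) :=
    fun a a' => M.integrableOn_hat_mul_hat K a a'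
  rw [hrhs, integral_finsetSum _ fun a _ => integrable_finsetSum _ fun a' _ =>
    (hint a a').const_mul _]
  refine Finset.sum_congr rfl fun a _ => ?_
  rw [integral_finsetSum _ fun a' _ => (hint a a').const_mul _,
    Matrix.mulVec, dotProduct, one_mul]
  refine Finset.sum_congr rfl fun a' _ => ?_
  rw [integral_const_mul, mass]
  ring

/-- Here `F_K / |K|` is the constant value of `f` on the element. -/
theorem load_mul_mass {f : Eu d → ℝ} {K : ι} {c : ℝ} (hf : ∀ x ∈ interior (M.elem K), f x = c)
    (z : Eu d → ℝ) :
    M.load f K * (M.elemMeasure K)⁻¹ *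
      ((fun _ : M.elemVertices K => (1 : ℝ)) ⬝ᵥ (M.mass K *ᵥ fun a => z a)) =
      ∫ x in M.elem K, f x * M.interp z x := by
  have hae : ∀ᵐ x ∂volume.restrict (M.elem K), f x = c := by
    rw [← M.restrict_interior_elem K]
    exact (ae_restrict_mem isOpen_interior.measurableSet).mono hf
  have hload : M.load f K = c * M.elemMeasure K := by
    rw [load, integral_congr_ae hae, setIntegral_const, smul_eq_mul, mul_comm]
    rfl
  rw [hload, mul_inv_cancel_right₀ (M.elemMeasure_pos K).ne', M.one_dotProduct_mass,
    ← integral_const_mul]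
  refine integral_congr_ae ?_
  filter_upwards [hae] with x hx
  rw [hx]

end PolytopalMesh

theorem energySq_le_sum_etaSq {d : ℕ} (hd : 1 ≤ d) {ι Φ : Type*} [Fintype ι] [Fintype Φ]
    {Ω : Set (Eu d)} (hΩ : IsOpen Ω) (hb : Bornology.IsBounded Ω) (hL : HasLipschitzBoundary Ω)
    {M : PolytopalMesh d Ω ι Φ} {Km : Eu d → Matrix (Fin d) (Fin d) ℝ}
    (hKm : ∀ K, ∃ k : Matrix (Fin d) (Fin d) ℝ, k.PosDef ∧ ∀ x ∈ interior (M.elem K), Km x = k)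
    {f : Eu d → ℝ} (hf : ∀ K, ∃ c : ℝ, ∀ x ∈ interior (M.elem K), f x = c)
    {p : Eu d → ℝ} {gradp : Eu d → Eu d} (hp : IsDarcySolution Ω Km f p gradp)
    {S : SaddlePointScheme M f} {ut : Eu d → Eu d} (hut : S.IsLifting Km ut) :
    0 ≤ energySq Km Ω (fun x => darcyFlux Km gradp x - ut x) ∧
      energySq Km Ω (fun x => darcyFlux Km gradp x - ut x) ≤ ∑ K, S.etaSq Km K := by
  have hdiv := hut.hasWeakDivergence hd hΩ hL
  have hpos : ∀ᵐ x ∂volume.restrict Ω, (Km x).PosDef := by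
    filter_upwards [M.ae_domain hΩ hL] with x ⟨K, hx⟩
    obtain ⟨k, hk, hkx⟩ := hKm K
    rwa [hkx x hx]
  set s := M.interp S.pointValue with hs_def
  have hs : IsH10 Ω s (gradient s) :=
    M.isH10_interp hΩ hb hL fun a ha => S.pointValue_of_mem_frontier ha
  have hgp := hp.isH10.weakGradient.memLp_grad
  have hgs := hs.weakGradient.memLp_grad
  have hK1 : ∀ {v : Eu d → Eu d}, MemLp v 2 (volume.restrict Ω) →
      MemLp (fun x => (Km x).toEuclideanLin (v x)) 2 (volume.restrict Ω) :=
    M.memLp_toEuclideanLin hΩ hL fun K => (hKm K).imp fun k hk => hk.2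
  have hK2 : MemLp (fun x => ((Km x)⁻¹).toEuclideanLin (ut x)) 2 (volume.restrict Ω) :=
    M.memLp_toEuclideanLin hΩ hL (A := fun x => (Km x)⁻¹) (fun K => by
      obtain ⟨k, -, hk⟩ := hKm K
      exact ⟨k⁻¹, fun x hx => by rw [hk x hx]⟩) hdiv.memLp
  have iuu := integrable_inner_of_memLp hdiv.memLp hK2
  have iup := integrable_inner_of_memLp hdiv.memLp hgp
  have ipp := integrable_inner_of_memLp (hK1 hgp) hgp
  have ips := integrable_inner_of_memLp (hK1 hgp) hgs
  have iss := integrable_inner_of_memLp (hK1 hgs) hgs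
  have ifs : Integrable (fun x => f x * s x) (volume.restrict Ω) :=
    MemLp.integrable_mul hdiv.memLp_div hs.weakGradient.memLp
  -- Green's formula turns the cross term into `-2 ∫ f p`, and testing with `p` turns the potential
  -- energy into `∫ f p`.
  have e1 : energySq Km Ω (fun x => darcyFlux Km gradp x - ut x) =
      (∫ x in Ω, ⟪ut x, ((Km x)⁻¹).toEuclideanLin (ut x)⟫) - ∫ x in Ω, f x * p x := by
    have h1 : energySq Km Ω (fun x => darcyFlux Km gradp x - ut x) =
        ∫ x in Ω, (⟪ut x, ((Km x)⁻¹).toEuclideanLin (ut x)⟫ + 2 * ⟪ut x, gradp x⟫ +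
          ⟪(Km x).toEuclideanLin (gradp x), gradp x⟫) :=
      integral_congr_ae (hpos.mono fun x hx => hx.inner_flux_sub (gradp x) (ut x))
    have h2 : Integrable (fun x => ⟪ut x, ((Km x)⁻¹).toEuclideanLin (ut x)⟫ +
        2 * ⟪ut x, gradp x⟫) (volume.restrict Ω) := iuu.add (iup.const_mul 2)
    rw [h1, integral_add h2 ipp, integral_add iuu (iup.const_mul 2),
      integral_const_mul, hdiv.integral_inner_eq hp.isH10, hp.weak_eq _ _ hp.isH10]
    ring
  -- Testing with `s` replaces the unknown `∫ f p` by computable terms; this is the only inequality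
  -- in the bound.
  have e2 : 2 * ∫ x in Ω, f x * s x ≤ (∫ x in Ω, f x * p x) +
      ∫ x in Ω, ⟪(Km x).toEuclideanLin (gradient s x), gradient s x⟫ := by
    rw [← hp.weak_eq _ _ hs, ← hp.weak_eq _ _ hp.isH10, ← integral_const_mul,
      ← integral_add ipp iss]
    exact integral_mono_ae (ips.const_mul 2) (ipp.add iss)
      (hpos.mono fun x hx => hx.two_mul_inner_le (gradp x) (gradient s x))
  -- Element by element the estimator matches these integrals up to the exterior flux terms, whose
  -- sum over the elements is zero.
  have e3 : ∑ K, S.etaSq Km K = (∫ x in Ω, ⟪ut x, ((Km x)⁻¹).toEuclideanLin (ut x)⟫) +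
      (∫ x in Ω, ⟪(Km x).toEuclideanLin (gradient s x), gradient s x⟫) -
      2 * ∫ x in Ω, f x * s x := by
    rw [M.setIntegral_domain hΩ hL iuu, M.setIntegral_domain hΩ hL iss,
      M.setIntegral_domain hΩ hL ifs]
    have h0 := S.sum_extFlux_dotProduct_Zext hd
    have hK : ∀ K, S.etaSq Km K =
        (∫ x in M.elem K, ⟪ut x, ((Km x)⁻¹).toEuclideanLin (ut x)⟫) +
        (∫ x in M.elem K, ⟪(Km x).toEuclideanLin (gradient s x), gradient s x⟫) +
        2 * (S.extFlux K ⬝ᵥ S.Zext K) - 2 * ∫ x in M.elem K, f x * s x := fun K => by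
      obtain ⟨k, -, hk⟩ := hKm K
      obtain ⟨c, hc⟩ := hf K
      have h1 := M.stiffness_quadratic hk S.pointValue
      have h2 := M.load_mul_mass hc S.pointValue
      have h3 := hut.energy K
      rw [energySq] at h3
      rw [hs_def, h3, ← h1, ← h2, SaddlePointScheme.etaSq]
      have hZ : S.Z K = fun a : M.elemVertices K => S.pointValue a := rfl
      rw [hZ]
      ring
    simp only [hK, Finset.sum_sub_distrib, Finset.sum_add_distrib, ← Finset.mul_sum, h0]
    ring
  refine ⟨integral_nonneg_of_ae (hpos.mono fun x hx => ?_), by linarith⟩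
  beta_reduce
  rw [Pi.zero_apply, ← hx.inv.inner_toEuclideanLin_comm]
  exact hx.inv.inner_toEuclideanLin_nonneg _


theorem mainTheorem5 {d : ℕ} (hd : 1 ≤ d) {ι Φ : Type*} [Fintype ι] [Fintype Φ]
    (Ω : Set (Eu d)) (hΩ_open : IsOpen Ω) (hΩ_bounded : Bornology.IsBounded Ω)
    (hΩ_connected : IsConnected Ω) (hΩ_lipschitz : HasLipschitzBoundary Ω)
    (M : PolytopalMesh d Ω ι Φ)
    (Km : Eu d → Matrix (Fin d) (Fin d) ℝ)
    (hKm : ∀ K, ∃ k : Matrix (Fin d) (Fin d) ℝ, k.PosDef ∧ ∀ x ∈ interior (M.elem K), Km x = k)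
    (f : Eu d → ℝ) (hf : ∀ K, ∃ c : ℝ, ∀ x ∈ interior (M.elem K), f x = c)
    (p : Eu d → ℝ) (gradp : Eu d → Eu d) (hp : IsDarcySolution Ω Km f p gradp)
    (S : SaddlePointScheme M f) (ut : Eu d → Eu d) (hut : S.IsLifting Km ut) :
    HasWeakDivergence Ω ut f ∧
    (∀ K, ∀ σ : M.elemFaces K, S.multiplier σ = S.elemMultiplier K σ) ∧
    0 ≤ ∑ K, S.etaSq Km K ∧
    energyNorm Km Ω (fun x => darcyFlux Km gradp x - ut x) ≤ √(∑ K, S.etaSq Km K) := by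
  have h := energySq_le_sum_etaSq hd hΩ_open hΩ_bounded hΩ_lipschitz hKm hf hp hut
  exact ⟨hut.hasWeakDivergence hd hΩ_open hΩ_lipschitz, S.multiplier_eq hd, h.1.trans h.2,
    Real.sqrt_le_sqrt h.2⟩
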